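/- Let $R$ be an associative ring with $1$, let $\mathcal H^?_*$ be an equivariant homology theory with values in $R$-modules (a $G$-homology theory $\mathcal H^G_*$ on $G$-CW-pairs for every discrete group $G$, together with induction homomorphisms $\mathcal H^H_n(X,A)\to\mathcal H^G_n(G\times_\alpha(X,A))$ for homomorphisms $\alpha:H\to G$ that are natural and compatible with the boundary maps, with composition, and with conjugation, and are bijective if $\ker\alpha$ acts freely on $X$), and let $\mathcal F$ be a class of groups closed under isomorphisms, subgroups and quotients. For a group $G$ let $\mathcal F_G$ be the family of all subgroups of $G$ that belong to $\mathcal F$. For a family $\mathcal E$ of subgroups of a group $K$ (closed under conjugation and subgroups) let $E_{\mathcal E}K$ be its classifying space: a $K$-CW-complex with all isotropy groups in $\mathcal E$ and with contractible $L$-fixed point set for every $L\in\mathcal E$. We say that $G$ satisfies FIC if for every group homomorphism $\varphi:K\to G$ and the family $\varphi^*\mathcal F_G=\{L\le K\mid\varphi(L)\in\mathcal F_G\}$ the projection $E_{\varphi^*\mathcal F_G}K\to \mathrm{pt}$ induces isomorphisms $\mathcal H^K_n(E_{\varphi^*\mathcal F_G}K)\to\mathcal H^K_n(\mathrm{pt})$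 for all $n\in\mathbb Z$. We say that $G$ satisfies FICwF if for every finite group $H$ the (regular) wreath product $G\wr H$ satisfies FIC. Consider the following properties: * (W2) FICwF holds for the fundamental groups of closed Riemannian manifolds of nonpositive sectional curvature. * (W3) FIC holds for virtually abelian groups. * (W4) If FIC holds for every group of a directed system $\{G_i\}_{i\in I}$, then FIC holds for $\operatorname{colim}_{i\in I}G_i$. * (W5) If $p:L\to G$ is a group homomorphism such that FIC holds for $G$ and for $p^{-1}(V)$ for every virtually cyclic subgroup $V$ of $G$, then FIC holds for $L$. Let $G_1$ and $G_2$ be countable groups. (a) If (W2), (W3), (W4) and (W5) hold for $(\mathcal H^?_*,\mathcal F)$ and $G_1$ and $G_2$ satisfy FICwF, then the free product $G_1*G_2$ satisfies FICwF. (b) For every virtually cyclic subgroup $V$ of $G_1\times G_2$ the preimage of $V$ under the canonical epimorphism $G_1*G_2\to G_1\times G_2$ is isomorphic to a subgroup of $F\wr H$ for some countable free group $F$ and some finite group $H$. -/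

import Mathlib

open CategoryTheory Set Topology
open scoped Manifold ContDiff

universe u v w

noncomputable section

/-! ### `G`-spaces, `G`-CW-pairs -/

/-- A pair `(X, A)` of `G`-spaces for a discrete group `G`: a topological space `X` on which `G`
acts by homeomorphisms, together with a `G`-invariant subset `A`. -/
structure GPair (G : Type u) [Group G] where
  /-- the ambient space `X` -/
  carrier : Type u
  [top : TopologicalSpace carrier]
  [act : MulAction G carrier]
  [cont : ContinuousConstSMul G carrier]
  /-- the subspace `A` -/
  sub : Set carrier
  smul_mem : ∀ (g : G) (x : carrier), x ∈ sub → g • x ∈ sub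

namespace GPair

attribute [instance] GPair.top GPair.act GPair.cont

variable {G : Type u} [Group G]

/-- A `G`-map of pairs. -/
@[ext]
structure Hom (P Q : GPair G) where
  toFun : P.carrier → Q.carrier
  continuous_toFun : Continuous toFun
  map_smul : ∀ (g : G) (x : P.carrier), toFun (g • x) = g • toFun x
  map_sub : ∀ x, x ∈ P.sub → toFun x ∈ Q.sub

/-- The identity map of a pair. -/
def Hom.id (P : GPair G) : Hom P P where
  toFun := fun x => x
  continuous_toFun := continuous_id
  map_smul _ _ := rfl
  map_sub _ h := h

/-- Composition of maps of pairs. -/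
def Hom.comp {P Q S : GPair G} (f : Hom P Q) (g : Hom Q S) : Hom P S where
  toFun := fun x => g.toFun (f.toFun x)
  continuous_toFun := g.continuous_toFun.comp f.continuous_toFun
  map_smul a x := by rw [f.map_smul, g.map_smul]
  map_sub x h := g.map_sub _ (f.map_sub x h)

/-- `(X, A)` is a `G`-CW-pair: `X` is Hausdorff and has a CW structure such that
* every `g : G` maps open cells onto open cells,
* if `g` maps some point of an open cell into that same cell, then `g` fixes the cell pointwise,
* `A` is a subcomplex.
For discrete `G` this is the same as being built by attaching equivariant cells `G/H × Dⁿ`. -/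
def IsGCW (P : GPair G) : Prop :=
  T2Space P.carrier ∧
  ∃ _ : CWComplex (univ : Set P.carrier),
    (∀ (n : ℕ) (i : RelCWComplex.cell (univ : Set P.carrier) n) (g : G),
      ∃ j : RelCWComplex.cell (univ : Set P.carrier) n,
        (fun x => g • x) '' RelCWComplex.openCell n i = RelCWComplex.openCell n j) ∧
    (∀ (n : ℕ) (i : RelCWComplex.cell (univ : Set P.carrier) n) (g : G) (x : P.carrier),
      x ∈ RelCWComplex.openCell n i → g • x ∈ RelCWComplex.openCell n i →
        ∀ y ∈ RelCWComplex.openCell n i, g • y = y) ∧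
    ∃ E : RelCWComplex.Subcomplex (univ : Set P.carrier), (E : Set P.carrier) = P.sub

/-- The pair `(X, ∅)` of a pair `(X, A)`. -/
def absPair (P : GPair G) : GPair G where
  carrier := P.carrier
  sub := ∅
  smul_mem _ _ h := h

instance subAct (P : GPair G) : MulAction G P.sub where
  smul g x := ⟨g • x.1, P.smul_mem g x.1 x.2⟩
  one_smul x := Subtype.ext (one_smul G x.1)
  mul_smul a b x := Subtype.ext (mul_smul a b x.1)

@[simp] lemma subAct_coe (P : GPair G) (g : G) (x : P.sub) :
    ((g • x : P.sub) : P.carrier) = g • (x : P.carrier) := rfl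

/-- The pair `(A, ∅)` of a pair `(X, A)`. -/
def subPair (P : GPair G) : GPair G where
  carrier := P.sub
  cont := ⟨fun g => Continuous.subtype_mk
    ((continuous_const_smul g).comp continuous_subtype_val) _⟩
  sub := ∅
  smul_mem _ _ h := h

/-- The one-point space, as a pair `(pt, ∅)`. -/
def point (G : Type u) [Group G] : GPair G where
  carrier := PUnit.{u + 1}
  act := { smul := fun _ x => x, one_smul := fun _ => rfl, mul_smul := fun _ _ _ => rfl }
  cont := ⟨fun _ => continuous_id⟩
  sub := ∅
  smul_mem _ _ h := h

lemma isGCW_absPair {P : GPair G} (h : P.IsGCW) : P.absPair.IsGCW := by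
  obtain ⟨h1, cw, h2, h3, -⟩ := h
  let _ : CWComplex (univ : Set P.absPair.carrier) := cw
  exact ⟨h1, cw, h2, h3,
    ⟨{ carrier := ∅, I := fun _ => ∅, closed' := isClosed_empty, union' := by simp }, rfl⟩⟩

/-- A CW structure on a subset `C` of `X`, seen as a CW structure on the subspace `C`. -/
@[reducible] def cwSubtype {X : Type u} [TopologicalSpace X] [T2Space X] (C : Set X)
    [CWComplex C] : CWComplex (univ : Set C) := by
  classical
  have hmem : ∀ (n : ℕ) (i : RelCWComplex.cell C n) (y : Fin n → ℝ),
      y ∈ Metric.closedBall (0 : Fin n → ℝ) 1 → RelCWComplex.map (C := C) n i y ∈ C :=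
    fun n i y hy => RelCWComplex.closedCell_subset_complex (C := C) n i ⟨y, hy, rfl⟩
  have h0 : ∀ (n : ℕ) (i : RelCWComplex.cell C n), RelCWComplex.map (C := C) n i 0 ∈ C :=
    fun n i => hmem n i 0 (by simp)
  let f : ∀ (n : ℕ) (i : RelCWComplex.cell C n), (Fin n → ℝ) → C := fun n i y =>
    if h : RelCWComplex.map (C := C) n i y ∈ C then ⟨_, h⟩ else ⟨_, h0 n i⟩
  have hf : ∀ (n : ℕ) (i : RelCWComplex.cell C n) (y : Fin n → ℝ),
      y ∈ Metric.closedBall (0 : Fin n → ℝ) 1 → (f n i y : X) = RelCWComplex.map (C := C) n i y := by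
    intro n i y hy
    simp [f, hmem n i y hy]
  have hsrc : ∀ (n : ℕ) (i : RelCWComplex.cell C n) (y : Fin n → ℝ),
      y ∈ Metric.ball (0 : Fin n → ℝ) 1 → y ∈ (RelCWComplex.map (C := C) n i).source := by
    intro n i y hy
    rw [RelCWComplex.source_eq]; exact hy
  have himg : ∀ (n : ℕ) (i : RelCWComplex.cell C n),
      f n i '' Metric.closedBall 0 1 = Subtype.val ⁻¹' RelCWComplex.closedCell (C := C) n i := by
    intro n i
    ext x
    constructor
    · rintro ⟨y, hy, rfl⟩
      exact ⟨y, hy, (hf n i y hy).symm⟩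
    · rintro ⟨y, hy, hx⟩
      exact ⟨y, hy, Subtype.ext ((hf n i y hy).trans hx)⟩
  have himg' : ∀ (n : ℕ) (i : RelCWComplex.cell C n),
      f n i '' Metric.ball 0 1 = Subtype.val ⁻¹' RelCWComplex.openCell (C := C) n i := by
    intro n i
    ext x
    constructor
    · rintro ⟨y, hy, rfl⟩
      exact ⟨y, hy, (hf n i y (Metric.ball_subset_closedBall hy)).symm⟩
    · rintro ⟨y, hy, hx⟩
      exact ⟨y, hy, Subtype.ext ((hf n i y (Metric.ball_subset_closedBall hy)).trans hx)⟩
  exact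
  { cell := RelCWComplex.cell C
    map := fun n i =>
      { toFun := f n i
        invFun := fun x => (RelCWComplex.map (C := C) n i).symm x
        source := Metric.ball 0 1
        target := Subtype.val ⁻¹' RelCWComplex.openCell (C := C) n i
        map_source' := fun y hy => by rw [← himg']; exact ⟨y, hy, rfl⟩
        map_target' := by
          rintro x ⟨y, hy, hx⟩
          rw [← hx, (RelCWComplex.map (C := C) n i).left_inv (hsrc n i y hy)]
          exact hy
        left_inv' := fun y hy => by
          rw [hf n i y (Metric.ball_subset_closedBall hy),
            (RelCWComplex.map (C := C) n i).left_inv (hsrc n i y hy)]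
        right_inv' := by
          rintro x ⟨y, hy, hx⟩
          apply Subtype.ext
          rw [← hx, (RelCWComplex.map (C := C) n i).left_inv (hsrc n i y hy),
            hf n i y (Metric.ball_subset_closedBall hy), hx] }
    source_eq := fun n i => rfl
    continuousOn := fun n i => by
      rw [Topology.IsInducing.subtypeVal.continuousOn_iff]
      exact (RelCWComplex.continuousOn (C := C) n i).congr fun y hy => hf n i y hy
    continuousOn_symm := fun n i => by
      refine (RelCWComplex.continuousOn_symm (C := C) n i).comp
        continuous_subtype_val.continuousOn ?_
      rintro x ⟨y, hy, hx⟩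
      rw [← hx]
      exact (RelCWComplex.map (C := C) n i).map_source (hsrc n i y hy)
    pairwiseDisjoint' := by
      intro a _ b _ hab
      have := CWComplex.pairwiseDisjoint (C := C) (mem_univ a) (mem_univ b) hab
      simp only [Function.onFun] at this ⊢
      change Disjoint (f _ _ '' _) (f _ _ '' _)
      rw [himg', himg']
      exact this.preimage _
    mapsTo' := fun n i => by
      obtain ⟨I, hI⟩ := CWComplex.mapsTo (C := C) n i
      refine ⟨I, fun y hy => ?_⟩
      have h1 := hI hy
      simp only [mem_iUnion] at h1 ⊢
      obtain ⟨m, hm, j, hj, z, hz, hzy⟩ := h1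
      refine ⟨m, hm, j, hj, z, hz, Subtype.ext ?_⟩
      exact (hf m j z hz).trans (hzy.trans (hf n i y (Metric.sphere_subset_closedBall hy)).symm)
    closed' := fun A _ hA => by
      have hC : IsClosed C := CWComplex.isClosed (C := C)
      have key : IsClosed (Subtype.val '' A : Set X) := by
        rw [CWComplex.closed C (Subtype.val '' A) (by rintro _ ⟨x, -, rfl⟩; exact x.2)]
        intro n j
        have h1 : IsClosed (A ∩ f n j '' Metric.closedBall 0 1) := hA n j
        rw [himg] at h1
        have h2 := hC.isClosedEmbedding_subtypeVal.isClosedMap _ h1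
        rwa [image_inter_preimage] at h2
      have := key.preimage (continuous_subtype_val (p := fun x => x ∈ C))
      rwa [preimage_image_eq _ Subtype.val_injective] at this
    union' := by
      rw [eq_univ_iff_forall]
      intro x
      have hx : (x : X) ∈ ⋃ (n : ℕ) (j : RelCWComplex.cell C n), RelCWComplex.closedCell (C := C) n j := by
        rw [CWComplex.union]; exact x.2
      simp only [mem_iUnion] at hx ⊢
      obtain ⟨n, j, hj⟩ := hx
      refine ⟨n, j, ?_⟩
      change x ∈ f n j '' Metric.closedBall 0 1
      rw [himg]
      exact hj }

lemma cwSubtype_openCell {X : Type u} [TopologicalSpace X] [T2Space X] (C : Set X)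
    [CWComplex C] (n : ℕ) (i : RelCWComplex.cell C n) :
    letI := cwSubtype C
    RelCWComplex.openCell (C := (univ : Set C)) n i =
      Subtype.val ⁻¹' RelCWComplex.openCell (C := C) n i := by
  have hb : ∀ y : Fin n → ℝ, y ∈ Metric.ball (0 : Fin n → ℝ) 1 →
      RelCWComplex.map (C := C) n i y ∈ C := fun y hy =>
    RelCWComplex.openCell_subset_complex (C := C) n i ⟨y, hy, rfl⟩
  have key : ∀ y : Fin n → ℝ, y ∈ Metric.ball (0 : Fin n → ℝ) 1 →
      letI := cwSubtype C
      ((RelCWComplex.map (C := (univ : Set C)) n i y : C) : X)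
        = RelCWComplex.map (C := C) n i y := by
    intro y hy
    exact congrArg Subtype.val (dif_pos (hb y hy))
  ext x
  constructor
  · rintro ⟨y, hy, rfl⟩
    exact ⟨y, hy, (key y hy).symm⟩
  · rintro ⟨y, hy, hx⟩
    exact ⟨y, hy, Subtype.ext ((key y hy).trans hx)⟩

lemma isGCW_subPair_aux {X : Type u} [TopologicalSpace X] [MulAction G X]
    [ContinuousConstSMul G X] [T2Space X] [CWComplex (univ : Set X)]
    (h2 : ∀ (n : ℕ) (i : RelCWComplex.cell (univ : Set X) n) (g : G),
      ∃ j : RelCWComplex.cell (univ : Set X) n,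
        (fun x => g • x) '' RelCWComplex.openCell n i = RelCWComplex.openCell n j)
    (h3 : ∀ (n : ℕ) (i : RelCWComplex.cell (univ : Set X) n) (g : G) (x : X),
      x ∈ RelCWComplex.openCell n i → g • x ∈ RelCWComplex.openCell n i →
        ∀ y ∈ RelCWComplex.openCell n i, g • y = y)
    (E : RelCWComplex.Subcomplex (univ : Set X)) (A : Set X) (hE : (E : Set X) = A)
    (hA : ∀ (g : G) (x : X), x ∈ A → g • x ∈ A) :
    (GPair.mk (G := G) X A hA).subPair.IsGCW := by
  subst hE
  let cw' : CWComplex (univ : Set (E : Set X)) := cwSubtype (E : Set X)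
  have hopen : ∀ (n : ℕ) (i : E.I n),
      RelCWComplex.openCell (C := (univ : Set (E : Set X))) n i =
        Subtype.val ⁻¹' RelCWComplex.openCell (C := (univ : Set X)) n i.1 :=
    fun n i => cwSubtype_openCell (E : Set X) n i
  refine ⟨inferInstanceAs (T2Space (E : Set X)), cw', ?_, ?_, ?_⟩
  · intro n i g
    obtain ⟨j, hj⟩ := h2 n i.1 g
    have hsub : RelCWComplex.openCell (C := (univ : Set X)) n j ⊆ (E : Set X) := by
      rw [← hj]
      rintro _ ⟨x, hx, rfl⟩
      exact hA g x (E.openCell_subset_of_mem i.2 hx)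
    have hjE : j ∈ E.I n := by
      by_contra hj'
      have hd := RelCWComplex.Subcomplex.disjoint_openCell_subcomplex_of_not_mem E hj'
      have hx : RelCWComplex.map (C := (univ : Set X)) n j 0 ∈
          RelCWComplex.openCell (C := (univ : Set X)) n j := ⟨0, by simp, rfl⟩
      exact disjoint_left.1 hd hx (hsub hx)
    refine ⟨⟨j, hjE⟩, ?_⟩
    refine (congrArg _ (hopen n i)).trans (Eq.trans ?_ (hopen n ⟨j, hjE⟩).symm)
    ext x
    constructor
    · rintro ⟨y, hy, rfl⟩
      change g • y.1 ∈ RelCWComplex.openCell (C := (univ : Set X)) n j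
      rw [← hj]
      exact ⟨y.1, hy, rfl⟩
    · intro hx
      change x.1 ∈ RelCWComplex.openCell (C := (univ : Set X)) n j at hx
      rw [← hj] at hx
      obtain ⟨y, hy, hyx⟩ := hx
      exact ⟨⟨y, E.openCell_subset_of_mem i.2 hy⟩, hy, Subtype.ext hyx⟩
  · intro n i g x hx hgx y hy
    have hx' := (congrArg (fun S => x ∈ S) (hopen n i)).mp hx
    have hgx' := (congrArg (fun S => g • x ∈ S) (hopen n i)).mp hgx
    have hy' := (congrArg (fun S => y ∈ S) (hopen n i)).mp hy
    exact Subtype.ext (h3 n i.1 g x.1 hx' hgx' y.1 hy')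
  · let _ : CWComplex (univ : Set (GPair.mk (G := G) X (E : Set X) hA).subPair.carrier) := cw'
    exact ⟨{ carrier := ∅, I := fun _ => ∅, closed' := isClosed_empty, union' := by simp }, rfl⟩

lemma isGCW_subPair {P : GPair G} (h : P.IsGCW) : P.subPair.IsGCW := by
  obtain ⟨h1, cw, h2, h3, E, hE⟩ := h
  exact isGCW_subPair_aux h2 h3 E P.sub hE P.smul_mem

lemma isGCW_point : (point G).IsGCW := by
  let cw : CWComplex (univ : Set PUnit.{u + 1}) :=
    { cell := fun n => ULift.{u} (PLift (n = 0))
      map := fun n i =>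
        { toFun := fun _ => PUnit.unit
          invFun := fun _ => 0
          source := Metric.ball 0 1
          target := univ
          map_source' := fun _ _ => mem_univ _
          map_target' := fun _ _ => by simp
          left_inv' := fun y _ => by
            obtain ⟨⟨rfl⟩⟩ := i
            exact Subsingleton.elim _ _
          right_inv' := fun _ _ => rfl }
      source_eq := fun _ _ => rfl
      continuousOn := fun _ _ => continuousOn_const
      continuousOn_symm := fun _ _ => continuousOn_const
      pairwiseDisjoint' := by
        rintro ⟨_, ⟨⟨rfl⟩⟩⟩ _ ⟨_, ⟨⟨rfl⟩⟩⟩ _ h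
        exact absurd rfl h
      mapsTo' := by
        rintro n ⟨⟨rfl⟩⟩
        refine ⟨fun _ => ∅, fun y hy => ?_⟩
        have h1 : y = 0 := Subsingleton.elim _ _
        rw [mem_sphere_zero_iff_norm, h1, norm_zero] at hy
        exact absurd hy zero_ne_one
      closed' := fun A _ _ => (isClosed_discrete A)
      union' := by
        rw [eq_univ_iff_forall]
        intro x
        simp only [mem_iUnion]
        exact ⟨0, ⟨⟨rfl⟩⟩, 0, by simp, rfl⟩ }
  have hcell : ∀ (n : ℕ) (i : RelCWComplex.cell (univ : Set PUnit.{u + 1}) n),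
      RelCWComplex.openCell (C := (univ : Set PUnit.{u + 1})) n i = univ := by
    intro n i
    rw [eq_univ_iff_forall]
    exact fun x => ⟨0, by simp, rfl⟩
  refine ⟨inferInstanceAs (T2Space PUnit.{u + 1}), cw, ?_, ?_, ?_⟩
  · intro n i g
    refine ⟨i, ?_⟩
    refine Eq.trans ?_ (hcell n i).symm
    refine eq_univ_iff_forall.2 fun x => ?_
    exact ⟨x, (hcell n i).symm ▸ mem_univ _, rfl⟩
  · intro n i g x _ _ y _
    rfl
  · let _ : CWComplex (univ : Set (point G).carrier) := cw
    exact ⟨{ carrier := ∅, I := fun _ => ∅, closed' := isClosed_empty, union' := by simp }, rfl⟩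

/-! ### Induction along a group homomorphism -/

section Induction

variable {H : Type u} [Group H]

/-- The relation on the disjoint union `G × X` of copies of `X` that identifies `(g α(h), x)`
with `(g, h x)`. -/
def indSetoid (α : H →* G) (X : Type u) [MulAction H X] : Setoid (Σ _ : G, X) where
  r p q := ∃ h : H, p.1 = q.1 * α h ∧ q.2 = h • p.2
  iseqv :=
    { refl := fun p => ⟨1, by simp, by simp⟩
      symm := by
        rintro p q ⟨h, h1, h2⟩
        exact ⟨h⁻¹, by simp [h1], by simp [h2]⟩
      trans := by
        rintro p q s ⟨h, h1, h2⟩ ⟨k, k1, k2⟩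
        exact ⟨k * h, by simp [h1, k1, mul_assoc], by simp [h2, k2, mul_smul]⟩ }

/-- The space `G ×_α X`, the quotient of `G × X` (with `G` discrete) by `(g α(h), x) ∼ (g, h x)`,
with the quotient topology. -/
def IndSpace (α : H →* G) (X : Type u) [MulAction H X] : Type u :=
  Quotient (indSetoid α X)

variable (α : H →* G) {X : Type u} [MulAction H X]

/-- The class of `(g, x)` in `G ×_α X`. -/
def IndSpace.mk (g : G) (x : X) : IndSpace α X := Quotient.mk (indSetoid α X) ⟨g, x⟩

variable {α} in
lemma IndSpace.mk_eq_mk_iff {g g' : G} {x x' : X} :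
    IndSpace.mk α g x = IndSpace.mk α g' x' ↔ ∃ h : H, g = g' * α h ∧ x' = h • x :=
  Quotient.eq (r := indSetoid α X)

lemma IndSpace.mk_mul (g : G) (h : H) (x : X) :
    IndSpace.mk α (g * α h) x = IndSpace.mk α g (h • x) :=
  IndSpace.mk_eq_mk_iff.2 ⟨h, rfl, rfl⟩

instance [TopologicalSpace X] : TopologicalSpace (IndSpace α X) :=
  inferInstanceAs (TopologicalSpace (Quotient (indSetoid α X)))

variable {α} in
lemma IndSpace.ind {p : IndSpace α X → Prop} (h : ∀ g x, p (IndSpace.mk α g x)) (y) : p y :=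
  Quotient.ind (fun q => h q.1 q.2) y

/-- Maps out of `G ×_α X`. -/
def IndSpace.lift {Y : Type u} (f : G → X → Y)
    (hf : ∀ g h x, f (g * α h) x = f g (h • x)) : IndSpace α X → Y :=
  Quotient.lift (fun q => f q.1 q.2) (by
    rintro ⟨g, x⟩ ⟨g', x'⟩ ⟨h, h1, h2⟩
    dsimp only at h1 h2 ⊢
    rw [h1, h2, hf])

lemma IndSpace.continuous_mk [TopologicalSpace X] (g : G) :
    Continuous (IndSpace.mk α g : X → IndSpace α X) :=
  continuous_quotient_mk'.comp continuous_sigmaMk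

lemma IndSpace.continuous_lift [TopologicalSpace X] {Y : Type u} [TopologicalSpace Y]
    (f : G → X → Y) (hf : ∀ g h x, f (g * α h) x = f g (h • x)) (hc : ∀ g, Continuous (f g)) :
    Continuous (IndSpace.lift α f hf) :=
  Continuous.quotient_lift (continuous_sigma hc) _

instance : MulAction G (IndSpace α X) where
  smul a := IndSpace.lift α (fun g x => IndSpace.mk α (a * g) x) (fun g h x => by
    rw [← mul_assoc, IndSpace.mk_mul])
  one_smul := IndSpace.ind fun g x => congrArg (fun a => IndSpace.mk α a x) (one_mul g)
  mul_smul a b := IndSpace.ind fun g x =>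
    congrArg (fun a => IndSpace.mk α a x) (mul_assoc a b g)

lemma IndSpace.smul_mk (a g : G) (x : X) :
    a • IndSpace.mk α g x = IndSpace.mk α (a * g) x := rfl

instance [TopologicalSpace X] : ContinuousConstSMul G (IndSpace α X) :=
  ⟨fun a => IndSpace.continuous_lift α _ _ fun g => IndSpace.continuous_mk α (a * g)⟩

/-- The induced pair `ind_α (X, A) = G ×_α (X, A)`. -/
def ind (P : GPair H) : GPair G where
  carrier := IndSpace α P.carrier
  sub := {y | ∃ (g : G) (x : P.carrier), x ∈ P.sub ∧ y = IndSpace.mk α g x}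
  smul_mem := by
    rintro a _ ⟨g, x, hx, rfl⟩
    exact ⟨a * g, x, hx, rfl⟩

/-- Induction on maps of pairs, `(g, x) ↦ (g, f x)`. -/
def indMap {P Q : GPair H} (f : Hom P Q) : Hom (ind α P) (ind α Q) where
  toFun := IndSpace.lift α (fun g x => IndSpace.mk α g (f.toFun x)) (fun g h x => by
    rw [f.map_smul, IndSpace.mk_mul])
  continuous_toFun := IndSpace.continuous_lift α _ _ fun g =>
    (IndSpace.continuous_mk α g).comp f.continuous_toFun
  map_smul a := IndSpace.ind fun g x => rfl
  map_sub := by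
    rintro _ ⟨g, x, hx, rfl⟩
    exact ⟨g, f.toFun x, f.map_sub x hx, rfl⟩

/-- The canonical map from `G ×_α A` to the subspace of `G ×_α X` given by `A`. -/
def indSub (P : GPair H) : Hom (ind α P.subPair) (ind α P).subPair where
  toFun := IndSpace.lift α (fun g (x : P.sub) =>
      (⟨IndSpace.mk α g x.1, g, x.1, x.2, rfl⟩ : (ind α P).sub))
    (fun g h x => Subtype.ext (IndSpace.mk_mul α g h x.1))
  continuous_toFun := IndSpace.continuous_lift α _ _ fun g =>
    ((IndSpace.continuous_mk α g).comp continuous_subtype_val).subtype_mk _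
  map_smul a := IndSpace.ind fun g x => rfl
  map_sub := by
    rintro _ ⟨g, x, hx, -⟩
    exact hx.elim

/-- The natural map `ind_β (ind_α X) → ind_{β ∘ α} X`, `(k, g, x) ↦ (k β(g), x)`. -/
def indComp {K : Type u} [Group K] (β : G →* K) (P : GPair H) :
    Hom (ind β (ind α P)) (ind (β.comp α) P) where
  toFun := IndSpace.lift β (fun k => IndSpace.lift α
      (fun g x => IndSpace.mk (β.comp α) (k * β g) x)
      (fun g h x => by
        rw [map_mul, ← mul_assoc]
        exact IndSpace.mk_mul (β.comp α) (k * β g) h x))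
    (fun k a => IndSpace.ind fun g x => by
      change IndSpace.mk (β.comp α) (k * β a * β g) x
        = IndSpace.mk (β.comp α) (k * β (a * g)) x
      rw [map_mul, mul_assoc])
  continuous_toFun := IndSpace.continuous_lift β _ _ fun k =>
    IndSpace.continuous_lift α _ _ fun g => IndSpace.continuous_mk (β.comp α) (k * β g)
  map_smul a := IndSpace.ind fun k => IndSpace.ind fun g x => by
    change IndSpace.mk (β.comp α) (a * k * β g) x = IndSpace.mk (β.comp α) (a * (k * β g)) x
    rw [mul_assoc]
  map_sub := by
    rintro _ ⟨k, _, ⟨g, x, hx, rfl⟩, rfl⟩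
    exact ⟨k * β g, x, hx, rfl⟩

end Induction

/-- The map `(X, A) → ind_{c(g)} (X, A)`, `x ↦ (1, g⁻¹ x)`, where `c(g)` is conjugation by `g`. -/
def toIndConj (g : G) (P : GPair G) : Hom P (ind (MulAut.conj g).toMonoidHom P) where
  toFun x := IndSpace.mk (MulAut.conj g).toMonoidHom 1 (g⁻¹ • x)
  continuous_toFun := (IndSpace.continuous_mk _ 1).comp (continuous_const_smul g⁻¹)
  map_smul a x := by
    refine IndSpace.mk_eq_mk_iff.2 ?_
    exact ⟨g⁻¹ * a⁻¹ * g, by simp [mul_assoc], by simp [mul_smul]⟩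
  map_sub x hx := ⟨1, g⁻¹ • x, P.smul_mem _ _ hx, rfl⟩

end GPair

/-- The category of `G`-CW-pairs and `G`-maps of pairs. -/
structure GCWPair (G : Type u) [Group G] extends GPair G where
  isGCW : toGPair.IsGCW

namespace GCWPair

variable {G : Type u} [Group G]

instance : Category (GCWPair G) where
  Hom P Q := GPair.Hom P.toGPair Q.toGPair
  id P := GPair.Hom.id P.toGPair
  comp f g := GPair.Hom.comp f g

/-- `(X, ∅)` -/
def absPair (P : GCWPair G) : GCWPair G := ⟨P.toGPair.absPair, GPair.isGCW_absPair P.isGCW⟩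

/-- `(A, ∅)` -/
def subPair (P : GCWPair G) : GCWPair G := ⟨P.toGPair.subPair, GPair.isGCW_subPair P.isGCW⟩

/-- `(pt, ∅)` -/
def point (G : Type u) [Group G] : GCWPair G := ⟨GPair.point G, GPair.isGCW_point⟩

/-- The inclusion `(A, ∅) → (X, ∅)`. -/
def subIncl (P : GCWPair G) : P.subPair ⟶ P.absPair where
  toFun := Subtype.val
  continuous_toFun := continuous_subtype_val
  map_smul _ _ := rfl
  map_sub _ h := h.elim

/-- The inclusion `(X, ∅) → (X, A)`. -/
def absIncl (P : GCWPair G) : P.absPair ⟶ P where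
  toFun := fun x => x
  continuous_toFun := continuous_id
  map_smul _ _ := rfl
  map_sub _ h := h.elim

/-- The map `(A, ∅) → (B, ∅)` induced by a map `(X, A) → (Y, B)`. -/
def subMap {P Q : GCWPair G} (f : P ⟶ Q) : P.subPair ⟶ Q.subPair where
  toFun := fun x => ⟨GPair.Hom.toFun f x.1, GPair.Hom.map_sub f x.1 x.2⟩
  continuous_toFun :=
    ((GPair.Hom.continuous_toFun f).comp continuous_subtype_val).subtype_mk _
  map_smul g x := Subtype.ext (GPair.Hom.map_smul f g x.1)
  map_sub _ h := h.elim

/-- The projection `X → pt`, for a pair `(X, ∅)`. -/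
def toPoint (P : GCWPair G) (hP : P.sub = ∅) : P ⟶ point G where
  toFun := fun _ => PUnit.unit
  continuous_toFun := continuous_const
  map_smul _ _ := rfl
  map_sub x h := by rw [hP] at h; exact h.elim

/-- `G`-homotopic maps of pairs. -/
def Homotopic {P Q : GCWPair G} (f₀ f₁ : P ⟶ Q) : Prop :=
  ∃ h : unitInterval × P.carrier → Q.carrier, Continuous h ∧
    (∀ (t : unitInterval) (g : G) (x : P.carrier), h (t, g • x) = g • h (t, x)) ∧ (∀ t, ∀ x ∈ P.sub, h (t, x) ∈ Q.sub) ∧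
    (∀ x, h (0, x) = GPair.Hom.toFun f₀ x) ∧ (∀ x, h (1, x) = GPair.Hom.toFun f₁ x)

/-- `F : (X, A) → (Y, B)` exhibits `Y` as the pushout `X ∪_f B` along its restriction
`f : A → B`: it is bijective from `X ∖ A` onto `Y ∖ B`, and `Y` carries the pushout topology. -/
def IsGluing {P Q : GCWPair G} (F : P ⟶ Q) : Prop :=
  BijOn (GPair.Hom.toFun F) P.subᶜ Q.subᶜ ∧
  ∀ U : Set Q.carrier, IsClosed U ↔
    IsClosed (GPair.Hom.toFun F ⁻¹' U) ∧ IsClosed ((Subtype.val : Q.sub → Q.carrier) ⁻¹' U)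

/-- The maps `j i : (X i, ∅) → (Y, ∅)` exhibit `Y` as the disjoint union of the `X i`. -/
def IsDisjointUnion {I : Type u} (P : I → GCWPair G) (Q : GCWPair G) (j : ∀ i, P i ⟶ Q) : Prop :=
  (∀ i, (P i).sub = ∅) ∧ Q.sub = ∅ ∧ (∀ i, IsOpenEmbedding (GPair.Hom.toFun (j i))) ∧
  Function.Bijective
    (fun p : Σ i, (P i).carrier => (GPair.Hom.toFun (j p.1) p.2 : Q.carrier))

end GCWPair

/-! ### Equivariant homology theories -/

/-- A `G`-homology theory with values in `R`-modules. -/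
structure GHomologyTheory (R : Type v) [Ring R] (G : Type u) [Group G] where
  /-- the functors `H_n` -/
  H : ℤ → GCWPair G ⥤ ModuleCat.{w} R
  /-- the boundary maps `∂_n : H_n(X, A) → H_{n-1}(A)` -/
  bd : ∀ (n : ℤ) (P : GCWPair G), (H n).obj P ⟶ (H (n - 1)).obj P.subPair
  bd_naturality : ∀ (n : ℤ) {P Q : GCWPair G} (f : P ⟶ Q),
    (H n).map f ≫ bd n Q = bd n P ≫ (H (n - 1)).map (GCWPair.subMap f)
  homotopy_invariance : ∀ (n : ℤ) {P Q : GCWPair G} (f₀ f₁ : P ⟶ Q),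
    GCWPair.Homotopic f₀ f₁ → (H n).map f₀ = (H n).map f₁
  exact_abs : ∀ (n : ℤ) (P : GCWPair G),
    Function.Exact ((H n).map P.subIncl).hom ((H n).map P.absIncl).hom
  exact_rel : ∀ (n : ℤ) (P : GCWPair G),
    Function.Exact ((H n).map P.absIncl).hom (bd n P).hom
  exact_sub : ∀ (n : ℤ) (P : GCWPair G),
    Function.Exact (bd n P).hom ((H (n - 1)).map P.subIncl).hom
  excision : ∀ (n : ℤ) {P Q : GCWPair G} (F : P ⟶ Q),
    GCWPair.IsGluing F → IsIso ((H n).map F)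
  disjoint_union : ∀ (n : ℤ) {I : Type u} [DecidableEq I] (P : I → GCWPair G) (Q : GCWPair G)
    (j : ∀ i, P i ⟶ Q), GCWPair.IsDisjointUnion P Q j →
    Function.Bijective (DirectSum.toModule R I ((H n).obj Q) fun i => ((H n).map (j i)).hom)

/-- The kernel of `α` acts freely on `X`. -/
def KerActsFreely {H G : Type u} [Group H] [Group G] (α : H →* G) (X : Type u) [MulAction H X] :
    Prop :=
  ∀ h ∈ α.ker, ∀ x : X, h • x = x → h = 1

/-- An equivariant homology theory with values in `R`-modules: a `G`-homology theory for every
group `G`, together with an induction structure. The induced pair of an `H`-CW-pair is a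
`G`-CW-pair; the hypotheses `hi`, `hi'`, ... merely name this property. -/
structure EquivariantHomologyTheory (R : Type v) [Ring R] where
  /-- the `G`-homology theories -/
  theory : ∀ (G : Type u) [Group G], GHomologyTheory.{u, v, w} R G
  /-- the induction homomorphisms -/
  ind : ∀ {H G : Type u} [Group H] [Group G] (α : H →* G) (n : ℤ) (P : GCWPair H)
    (hi : (P.toGPair.ind α).IsGCW),
    ((theory H).H n).obj P ⟶ ((theory G).H n).obj ⟨P.toGPair.ind α, hi⟩
  ind_naturality : ∀ {H G : Type u} [Group H] [Group G] (α : H →* G) (n : ℤ) {P Q : GCWPair H}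
    (f : P ⟶ Q) (hi : (P.toGPair.ind α).IsGCW) (hi' : (Q.toGPair.ind α).IsGCW),
    ((theory H).H n).map f ≫ ind α n Q hi' =
      ind α n P hi ≫ ((theory G).H n).map
        (X := ⟨P.toGPair.ind α, hi⟩) (Y := ⟨Q.toGPair.ind α, hi'⟩) (GPair.indMap α f)
  /-- compatibility with the boundary maps -/
  ind_bd : ∀ {H G : Type u} [Group H] [Group G] (α : H →* G) (n : ℤ) (P : GCWPair H)
    (hi : (P.toGPair.ind α).IsGCW) (hi' : (P.subPair.toGPair.ind α).IsGCW),
    ind α n P hi ≫ (theory G).bd n ⟨P.toGPair.ind α, hi⟩ =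
      (theory H).bd n P ≫ ind α (n - 1) P.subPair hi' ≫
        ((theory G).H (n - 1)).map (X := ⟨P.subPair.toGPair.ind α, hi'⟩)
          (Y := GCWPair.subPair ⟨P.toGPair.ind α, hi⟩) (GPair.indSub α P.toGPair)
  /-- functoriality in `α` -/
  ind_comp : ∀ {H G K : Type u} [Group H] [Group G] [Group K] (α : H →* G) (β : G →* K) (n : ℤ)
    (P : GCWPair H) (hi : (P.toGPair.ind α).IsGCW) (hi' : ((P.toGPair.ind α).ind β).IsGCW)
    (hi'' : (P.toGPair.ind (β.comp α)).IsGCW),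
    KerActsFreely (β.comp α) P.carrier →
    ind (β.comp α) n P hi'' =
      ind α n P hi ≫ ind β n ⟨P.toGPair.ind α, hi⟩ hi' ≫
        ((theory K).H n).map (X := ⟨(P.toGPair.ind α).ind β, hi'⟩)
          (Y := ⟨P.toGPair.ind (β.comp α), hi''⟩) (GPair.indComp α β P.toGPair)
  /-- compatibility with conjugation -/
  ind_conj : ∀ {G : Type u} [Group G] (g : G) (n : ℤ) (P : GCWPair G)
    (hi : (P.toGPair.ind (MulAut.conj g).toMonoidHom).IsGCW),
    ind (MulAut.conj g).toMonoidHom n P hi =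
      ((theory G).H n).map (Y := ⟨P.toGPair.ind (MulAut.conj g).toMonoidHom, hi⟩)
        (GPair.toIndConj g P.toGPair)
  /-- bijectivity -/
  ind_bijective : ∀ {H G : Type u} [Group H] [Group G] (α : H →* G) (n : ℤ) (P : GCWPair H)
    (hi : (P.toGPair.ind α).IsGCW), KerActsFreely α P.carrier → IsIso (ind α n P hi)

/-! ### Families of subgroups and isomorphism conjectures -/

/-- A family of subgroups of `G`: a set of subgroups closed under conjugation and subgroups. -/
@[ext]
structure SubgroupFamily (G : Type u) [Group G] where
  /-- the members of the family -/
  carrier : Set (Subgroup G)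
  conj_mem : ∀ (g : G) (H : Subgroup G), H ∈ carrier →
    H.map (MulAut.conj g).toMonoidHom ∈ carrier
  le_mem : ∀ (H L : Subgroup G), H ∈ carrier → L ≤ H → L ∈ carrier

/-- The family `φ^* F = {H ≤ K | φ(H) ∈ F}`. -/
def SubgroupFamily.pullback {K G : Type u} [Group K] [Group G] (φ : K →* G)
    (F : SubgroupFamily G) : SubgroupFamily K where
  carrier := {H | H.map φ ∈ F.carrier}
  conj_mem k H hH := by
    have h : (H.map (MulAut.conj k).toMonoidHom).map φ
        = (H.map φ).map (MulAut.conj (φ k)).toMonoidHom := by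
      rw [Subgroup.map_map, Subgroup.map_map]
      congr 1
      ext x
      simp
    change (H.map (MulAut.conj k).toMonoidHom).map φ ∈ F.carrier
    rw [h]
    exact F.conj_mem _ _ hH
  le_mem H L hH hL := F.le_mem _ _ hH (Subgroup.map_mono hL)

/-- A class of groups closed under isomorphisms, subgroups and quotients. -/
structure GroupClass where
  /-- membership in the class -/
  Mem : ∀ (G : Type u) [Group G], Prop
  of_equiv : ∀ {G G' : Type u} [Group G] [Group G'], G ≃* G' → Mem G → Mem G'
  subgroup : ∀ {G : Type u} [Group G] (H : Subgroup G), Mem G → Mem H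
  quotient : ∀ {G : Type u} [Group G] (N : Subgroup G) [N.Normal], Mem G → Mem (G ⧸ N)

/-- The family `𝓕_G` of the subgroups of `G` that belong to the class `𝓕`. -/
def GroupClass.family (𝓕 : GroupClass.{u}) (G : Type u) [Group G] : SubgroupFamily G where
  carrier := {H | 𝓕.Mem H}
  conj_mem g H hH :=
    𝓕.of_equiv (H.equivMapOfInjective (MulAut.conj g).toMonoidHom (MulAut.conj g).injective) hH
  le_mem _ _ hH hL := 𝓕.of_equiv (Subgroup.subgroupOfEquivOfLe hL) (𝓕.subgroup _ hH)

/-- `E` (with empty second component) is a model for the classifying space `E_F G` of the family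
`F`: a `G`-CW-complex whose isotropy groups belong to `F` and whose fixed point sets under members
of `F` are contractible. -/
structure IsClassifyingSpace {G : Type u} [Group G] (F : SubgroupFamily G) (E : GCWPair G) :
    Prop where
  sub_eq : E.sub = ∅
  stabilizer_mem : ∀ x : E.carrier, MulAction.stabilizer G x ∈ F.carrier
  contractible : ∀ H ∈ F.carrier, ContractibleSpace (MulAction.fixedPoints H E.carrier)

variable {R : Type v} [Ring R]

/-- The isomorphism conjecture for `(G, F, ℋ)`: the projection `E_F G → pt` induces isomorphisms
`ℋ^G_n(E_F G) → ℋ^G_n(pt)` for all `n`. The model of `E_F G` is unique up to `G`-homotopy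
equivalence, so that it does not matter which one is taken. -/
def SatisfiesIC (ℋ : EquivariantHomologyTheory.{u, v, w} R) (G : Type u) [Group G]
    (F : SubgroupFamily G) : Prop :=
  ∃ (E : GCWPair G) (hE : IsClassifyingSpace F E),
    ∀ n : ℤ, IsIso (((ℋ.theory G).H n).map (E.toPoint hE.sub_eq))

/-- The fibered isomorphism conjecture for `(G, F, ℋ)`. -/
def FibredIC (ℋ : EquivariantHomologyTheory.{u, v, w} R) (G : Type u) [Group G]
    (F : SubgroupFamily G) : Prop :=
  ∀ (K : Type u) [Group K] (φ : K →* G), SatisfiesIC ℋ K (F.pullback φ)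

/-- The fibered isomorphism conjecture for `(G, 𝓕_G, ℋ)`. -/
def SatisfiesFIC (ℋ : EquivariantHomologyTheory.{u, v, w} R) (𝓕 : GroupClass.{u})
    (G : Type u) [Group G] : Prop :=
  FibredIC ℋ G (𝓕.family G)

/-- The fibered isomorphism conjecture with finite extensions for `(G, 𝓕_G, ℋ)`: the fibered
isomorphism conjecture for all wreath products `G ≀ H` with `H` finite. -/
def SatisfiesFICwF (ℋ : EquivariantHomologyTheory.{u, v, w} R) (𝓕 : GroupClass.{u})
    (G : Type u) [Group G] : Prop :=
  ∀ (H : Type u) [Group H] [Finite H], SatisfiesFIC ℋ 𝓕 (G ≀ᵣ H)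

/-! ### Nonpositively curved manifolds -/

section Curvature

variable {n : ℕ}

/-- The partial derivative `∂_i f`. -/
def partialDeriv (i : Fin n) (f : EuclideanSpace ℝ (Fin n) → ℝ) (y : EuclideanSpace ℝ (Fin n)) :
    ℝ :=
  fderiv ℝ f y (EuclideanSpace.single i 1)

/-- The Christoffel symbol `Γ^k_{ij}` of a metric `(g_{ij})` given in coordinates. -/
def christoffel (g : EuclideanSpace ℝ (Fin n) → Matrix (Fin n) (Fin n) ℝ) (k i j : Fin n)
    (y : EuclideanSpace ℝ (Fin n)) : ℝ :=
  (1 / 2) * ∑ l, (g y)⁻¹ k l *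
    (partialDeriv i (fun z => g z j l) y + partialDeriv j (fun z => g z i l) y
      - partialDeriv l (fun z => g z i j) y)

/-- The coefficient of `∂_l` in `R(∂_i, ∂_j) ∂_k = ∇_i ∇_j ∂_k - ∇_j ∇_i ∂_k`. -/
def riemannTensor (g : EuclideanSpace ℝ (Fin n) → Matrix (Fin n) (Fin n) ℝ) (l i j k : Fin n)
    (y : EuclideanSpace ℝ (Fin n)) : ℝ :=
  partialDeriv i (christoffel g l j k) y - partialDeriv j (christoffel g l i k) y
    + ∑ m, (christoffel g l i m y * christoffel g m j k y
      - christoffel g l j m y * christoffel g m i k y)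

/-- `⟨R(u, v) v, u⟩`, which is the sectional curvature of the plane spanned by `u` and `v` times
`|u|² |v|² - ⟨u, v⟩²`. -/
def curvatureForm (g : EuclideanSpace ℝ (Fin n) → Matrix (Fin n) (Fin n) ℝ)
    (y : EuclideanSpace ℝ (Fin n)) (u v : Fin n → ℝ) : ℝ :=
  ∑ i, ∑ j, ∑ k, ∑ l, ∑ m, u i * v j * v k * u m * g y l m * riemannTensor g l i j k y

variable {M : Type u} [TopologicalSpace M] [ChartedSpace (EuclideanSpace ℝ (Fin n)) M]
  [IsManifold (𝓡 n) ∞ M]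

/-- The coefficients `g_{ij} = g(∂_i, ∂_j)` of a Riemannian metric in the chart at `x`. -/
def metricInChart
    (g : Bundle.ContMDiffRiemannianMetric (𝓡 n) ∞ (EuclideanSpace ℝ (Fin n))
      (fun p : M => TangentSpace (𝓡 n) p))
    (x : M) (y : EuclideanSpace ℝ (Fin n)) : Matrix (Fin n) (Fin n) ℝ :=
  Matrix.of fun i j =>
    g.inner ((extChartAt (𝓡 n) x).symm y)
      (mfderiv 𝓘(ℝ, EuclideanSpace ℝ (Fin n)) (𝓡 n) (extChartAt (𝓡 n) x).symm y
        (EuclideanSpace.single i 1 : EuclideanSpace ℝ (Fin n)))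
      (mfderiv 𝓘(ℝ, EuclideanSpace ℝ (Fin n)) (𝓡 n) (extChartAt (𝓡 n) x).symm y
        (EuclideanSpace.single j 1 : EuclideanSpace ℝ (Fin n)))

/-- All sectional curvatures of the Riemannian metric are `≤ 0`. -/
def IsNonpositivelyCurved
    (g : Bundle.ContMDiffRiemannianMetric (𝓡 n) ∞ (EuclideanSpace ℝ (Fin n))
      (fun p : M => TangentSpace (𝓡 n) p)) : Prop :=
  ∀ (x : M) (u v : Fin n → ℝ), curvatureForm (metricInChart g x) (extChartAt (𝓡 n) x x) u v ≤ 0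

end Curvature

/-! ### Inheritance properties -/

/-- `G` is virtually abelian. -/
def VirtuallyAbelian (G : Type u) [Group G] : Prop :=
  ∃ A : Subgroup G, A.FiniteIndex ∧ IsMulCommutative A

/-- `G` is virtually cyclic. -/
def VirtuallyCyclic (G : Type u) [Group G] : Prop :=
  ∃ C : Subgroup G, C.FiniteIndex ∧ IsCyclic C

variable (ℋ : EquivariantHomologyTheory.{u, v, w} R) (𝓕 : GroupClass.{u})

/-- The property that FICwF holds for fundamental groups of closed nonpositively curved manifolds. -/
def FICwFForNonpositivelyCurved : Prop :=
  ∀ (n : ℕ) (M : Type u) [TopologicalSpace M] [T2Space M] [CompactSpace M] [ConnectedSpace M]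
    [ChartedSpace (EuclideanSpace ℝ (Fin n)) M] [IsManifold (𝓡 n) ∞ M]
    (g : Bundle.ContMDiffRiemannianMetric (𝓡 n) ∞ (EuclideanSpace ℝ (Fin n))
      (fun p : M => TangentSpace (𝓡 n) p)),
    IsNonpositivelyCurved g → ∀ x : M, SatisfiesFICwF ℋ 𝓕 (FundamentalGroup M x)

/-- The property that FIC holds for virtually abelian groups. -/
def FICForVirtuallyAbelian : Prop :=
  ∀ (G : Type u) [Group G], VirtuallyAbelian G → SatisfiesFIC ℋ 𝓕 G

/-- The property that FIC passes to colimits of directed systems of groups. -/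
def FICForColimits : Prop :=
  ∀ (I : Type u) [Preorder I] [IsDirectedOrder I] [Nonempty I] (G : I → Type u) [∀ i, Group (G i)]
    (f : ∀ i j, i ≤ j → G i →* G j) [DirectedSystem G fun i j h => f i j h],
    (∀ i, SatisfiesFIC ℋ 𝓕 (G i)) → SatisfiesFIC ℋ 𝓕 (DirectLimit G f)

/-- The property that if FIC holds for `G` and for `p⁻¹(V)` for all virtually cyclic subgroups `V` of `G`, then
FIC holds for `L`, where `p : L → G` is a homomorphism. -/
def FICForPreimages : Prop :=
  ∀ (L G : Type u) [Group L] [Group G] (p : L →* G), SatisfiesFIC ℋ 𝓕 G →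
    (∀ V : Subgroup G, VirtuallyCyclic V → SatisfiesFIC ℋ 𝓕 (V.comap p)) → SatisfiesFIC ℋ 𝓕 L

end

/-! Let `p : G₁ * G₂ → G₁ × G₂` be the canonical map. It is injective on each factor and on each
conjugate of a factor. A virtually cyclic `V` has a free subgroup `D` of finite index (of rank at
most one), and `p⁻¹(D)` meets every conjugate of a factor in a group that embeds into `D`, so in a
free group. By a Kurosh type argument `p⁻¹(D)` is free. It has finite index in `p⁻¹(V)`, so the
Kaloujnine-Krasner embedding of an extension into a wreath product, applied to its normal core,
gives (b).

The Kurosh argument uses groupoids. The action groupoid of `G₁ * G₂` on the cosets of `p⁻¹(D)` is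
the pushout, over a fixed set of objects, of the action groupoids of the two factors. Each of these
is free because its vertex groups are free (`hasFreeCocycles_of_stabilizer`), so the pushout is free
(`HasFreeCocycles.coprod`), and vertex groups of connected free groupoids are free. Freeness is
expressed by the universal property of cocycles, which are homomorphisms to a semidirect product;
the pushout is then the universal property of the free product.

For (a), the preimage property is applied to `(G₁ * G₂) ≀ H → (G₁ × G₂) ≀ H`. The target is handled
by two applications of the same property to projections, with virtually abelian fibres. The preimage
of a virtually cyclic subgroup has a finite index subgroup inside a product over `H` of preimages
`p⁻¹(C)` with `C` cyclic, so it virtually embeds into a finite power of a countable free group `F`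
(`VirtuallyFreePower.comap_mapLeft`). Kaloujnine-Krasner then embeds it into a finite power of `F ≀
Q` with `Q` finite, and FICwF for `F` suffices.

FICwF for `F` follows from the manifold hypothesis once one closed nonpositively curved manifold has
a fundamental group containing a free group of rank two, since that group contains `F`. The manifold
is an explicit hyperbolic surface: the quotient of the upper half plane by the norm one units
congruent to `1` modulo `3` in the order `ℤ⟨1, i, j, ij⟩`, `i² = -1`, `j² = 3`. The congruence makes
the action free, Minkowski's theorem and anisotropy of the norm make it cocompact, and ping-pong
yields the free subgroup. -/

lemma Subgroup.finiteIndex_comap {G G' : Type*} [Group G] [Group G'] (f : G →* G')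
    (N : Subgroup G') [N.FiniteIndex] : (N.comap f).FiniteIndex :=
  ⟨by rw [Subgroup.index_comap]
      exact (Subgroup.instFiniteIndex_subgroupOf N f.range).index_ne_zero⟩

/-! ### Wreath products -/

namespace RegularWreathProduct

variable {D D' Q : Type*} [Group D] [Group D'] [Group Q]

/-- The homomorphism of wreath products induced by a homomorphism of the base groups. -/
def mapLeft (Q : Type*) [Group Q] (f : D →* D') : D ≀ᵣ Q →* D' ≀ᵣ Q where
  toFun x := ⟨fun q => f (x.left q), x.right⟩
  map_one' := by ext <;> simp
  map_mul' x y := by ext <;> simp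

lemma mapLeft_injective {f : D →* D'} (hf : Function.Injective f) :
    Function.Injective (mapLeft Q f) := by
  intro x y h
  ext q
  · exact hf (congrFun (congrArg left h) q)
  · have := congrArg right h
    exact this

/-- The wreath product of a product of groups maps to the product of the wreath products. -/
def piHom {ι : Type*} (D : ι → Type*) [∀ i, Group (D i)] (Q : Type*) [Group Q] :
    (∀ i, D i) ≀ᵣ Q →* ∀ i, D i ≀ᵣ Q :=
  MonoidHom.pi fun i => mapLeft Q (Pi.evalMonoidHom D i)

/-- The index set must be nonempty: the component in `Q` is visible only through some factor. -/
lemma piHom_injective {ι : Type*} [Nonempty ι] (D : ι → Type*) [∀ i, Group (D i)] :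
    Function.Injective (piHom D Q) := by
  intro x y h
  ext q i
  · exact congrFun (congrArg left (congrFun h i)) q
  · have := congrArg right (congrFun h (Classical.arbitrary ι))
    exact this

lemma prodHom_injective :
    Function.Injective ((mapLeft Q (MonoidHom.fst D D')).prod (mapLeft Q (MonoidHom.snd D D'))) := by
  intro x y h
  have h1 := congrArg Prod.fst h
  have h2 := congrArg Prod.snd h
  ext q
  · exact congrFun (congrArg left h1) q
  · exact congrFun (congrArg left h2) q
  · have := congrArg right h1
    exact this

instance finiteIndex_ker_rightHom [Finite Q] : (rightHom : D ≀ᵣ Q →* Q).ker.FiniteIndex :=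
  inferInstance

/-- The embedding of an extension of `Q = G ⧸ N` by `N` into the wreath product `N ≀ Q`. -/
noncomputable def ofExtension {G : Type*} [Group G] (N : Subgroup G) [N.Normal] :
    G →* N ≀ᵣ (G ⧸ N) where
  -- Kaloujnine-Krasner: with the set-theoretic section `s = Quotient.out`, the coordinate at `x` is
  -- `s(x)⁻¹ g s(g⁻¹x)`, which lies in `N` and satisfies the cocycle rule of the wreath product.
  toFun g := ⟨fun x => ⟨x.out⁻¹ * g * ((g : G ⧸ N)⁻¹ * x).out, by
    rw [← QuotientGroup.eq_one_iff]
    simp⟩, g⟩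
  map_one' := by ext <;> simp
  map_mul' g h := by
    ext
    · simp [mul_assoc]
    · simp

lemma ofExtension_injective {G : Type*} [Group G] (N : Subgroup G) [N.Normal] :
    Function.Injective (ofExtension N) := by
  rw [injective_iff_map_eq_one]
  intro g hg
  have h1 : (g : G ⧸ N) = 1 := congrArg right hg
  -- Once `g` is trivial in the quotient, the coordinate at `1` is a conjugate of `g`.
  have h2 := congrArg Subtype.val (congrFun (congrArg left hg) 1)
  simp only [ofExtension, MonoidHom.coe_mk, OneHom.coe_mk, h1] at h2
  simpa [mul_assoc, mul_eq_one_iff_eq_inv] using h2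

end RegularWreathProduct

/-! ### Groups that virtually embed into powers of a countable free group -/

/-- `G` has a subgroup of finite index that embeds into a finite power of a countable free group. -/
def VirtuallyFreePower (G : Type u) [Group G] : Prop :=
  ∃ N : Subgroup G, N.FiniteIndex ∧ ∃ (ι : Type u) (_ : Finite ι)
    (f : N →* (ι → FreeGroup (ULift.{u} ℤ))), Function.Injective f

namespace VirtuallyFreePower

lemma of_embedding {G : Type u} [Group G] (f : G →* FreeGroup (ULift.{u} ℤ))
    (hf : Function.Injective f) : VirtuallyFreePower G :=
  ⟨⊤, inferInstance, PUnit, inferInstance, MonoidHom.pi fun _ => f.comp (Subgroup.subtype ⊤),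
    fun _ _ h => Subtype.ext (hf (congrFun h PUnit.unit))⟩

lemma of_injective {G G' : Type u} [Group G] [Group G'] (f : G →* G') (hf : Function.Injective f)
    (h : VirtuallyFreePower G') : VirtuallyFreePower G := by
  obtain ⟨N, hN, ι, hι, φ, hφ⟩ := h
  refine ⟨N.comap f, N.finiteIndex_comap f, ι, hι, φ.comp (f.subgroupComap N), hφ.comp ?_⟩
  intro x y hxy
  exact Subtype.ext (hf (congrArg Subtype.val hxy))

lemma of_finiteIndex {G : Type u} [Group G] (N : Subgroup G) [hN : N.FiniteIndex]
    (h : VirtuallyFreePower N) : VirtuallyFreePower G := by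
  obtain ⟨N', hN', ι, hι, φ, hφ⟩ := h
  have e := (N'.equivMapOfInjective N.subtype N.subtype_injective).symm
  refine ⟨N'.map N.subtype, ⟨?_⟩, ι, hι, φ.comp e.toMonoidHom, hφ.comp e.injective⟩
  rw [Subgroup.index_map_subtype]
  exact mul_ne_zero hN'.index_ne_zero hN.index_ne_zero

lemma pi {ι : Type u} [Finite ι] {G : ι → Type u} [∀ i, Group (G i)]
    (h : ∀ i, VirtuallyFreePower (G i)) : VirtuallyFreePower (∀ i, G i) := by
  choose N hN κ hκ φ hφ using h
  refine ⟨⨅ i, (N i).comap (Pi.evalMonoidHom G i), ?_, Σ i, κ i, inferInstance,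
    MonoidHom.pi fun p => (Pi.evalMonoidHom _ p.2).comp ((φ p.1).comp
      (((Pi.evalMonoidHom G p.1).subgroupComap (N p.1)).comp
        (Subgroup.inclusion (iInf_le _ p.1)))), ?_⟩
  · exact Subgroup.finiteIndex_iInf fun i => Subgroup.finiteIndex_comap _ _
  · intro x y hxy
    ext i
    have : φ i ⟨x.1 i, Subgroup.mem_iInf.1 x.2 i⟩ = φ i ⟨y.1 i, Subgroup.mem_iInf.1 y.2 i⟩ := by
      funext k
      exact congrFun hxy ⟨i, k⟩
    exact congrArg Subtype.val (hφ i this)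

end VirtuallyFreePower

/-! ### Inheritance properties of the fibred isomorphism conjecture -/

/-- An injective `f` identifies `H` with its image, and the class is invariant under isomorphism.
This is what lets the fibred conjecture pass to subgroups. -/
lemma GroupClass.family_pullback (𝓕 : GroupClass.{u}) {L G : Type u} [Group L] [Group G]
    (f : L →* G) (hf : Function.Injective f) : (𝓕.family G).pullback f = 𝓕.family L := by
  ext H
  exact ⟨𝓕.of_equiv (H.equivMapOfInjective f hf).symm, 𝓕.of_equiv (H.equivMapOfInjective f hf)⟩

lemma SubgroupFamily.pullback_comp {K L G : Type u} [Group K] [Group L] [Group G] (φ : K →* L)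
    (f : L →* G) (F : SubgroupFamily G) : F.pullback (f.comp φ) = (F.pullback f).pullback φ := by
  ext H
  change H.map (f.comp φ) ∈ F.carrier ↔ (H.map φ).map f ∈ F.carrier
  rw [Subgroup.map_map]

section FIC

variable {R : Type v} [Ring R] {ℋ : EquivariantHomologyTheory.{u, v, w} R} {𝓕 : GroupClass.{u}}

/-- A homomorphism `K → L` can be continued to `G` without changing the pulled back family on `K`,
so the conjecture for `L` is a special case of that for `G`. -/
lemma SatisfiesFIC.of_injective {L G : Type u} [Group L] [Group G] (h : SatisfiesFIC ℋ 𝓕 G)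
    (f : L →* G) (hf : Function.Injective f) : SatisfiesFIC ℋ 𝓕 L := by
  intro K _ φ
  have := h K (f.comp φ)
  rwa [SubgroupFamily.pullback_comp, 𝓕.family_pullback f hf] at this

lemma SatisfiesFICwF.of_injective {L G : Type u} [Group L] [Group G] (h : SatisfiesFICwF ℋ 𝓕 G)
    (f : L →* G) (hf : Function.Injective f) : SatisfiesFICwF ℋ 𝓕 L := fun H _ _ =>
  (h H).of_injective _ (RegularWreathProduct.mapLeft_injective (Q := H) hf)

lemma VirtuallyCyclic.virtuallyAbelian {G : Type u} [Group G] (h : VirtuallyCyclic G) :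
    VirtuallyAbelian G := by
  obtain ⟨C, hC, hC'⟩ := h
  exact ⟨C, hC, IsCyclic.isMulCommutative⟩

lemma VirtuallyAbelian.prod {G G' : Type u} [Group G] [Group G'] (h : VirtuallyAbelian G)
    (h' : VirtuallyAbelian G') : VirtuallyAbelian (G × G') := by
  obtain ⟨A, hA, hAc⟩ := h
  obtain ⟨B, hB, hBc⟩ := h'
  refine ⟨A.prod B, ⟨?_⟩, ⟨⟨?_⟩⟩⟩
  · rw [Subgroup.index_prod]
    exact mul_ne_zero hA.index_ne_zero hB.index_ne_zero
  · rintro ⟨⟨a, b⟩, ha, hb⟩ ⟨⟨a', b'⟩, ha', hb'⟩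
    have h1 := congrArg Subtype.val (hAc.is_comm.comm ⟨a, ha⟩ ⟨a', ha'⟩)
    have h2 := congrArg Subtype.val (hBc.is_comm.comm ⟨b, hb⟩ ⟨b', hb'⟩)
    exact Subtype.ext (Prod.ext h1 h2)

/-- The preimage of `V ≤ G` under the first projection is `V × G'`. Projecting this to `G'`, the
preimage of `V'` is `V × V'`, which is virtually abelian if `V` and `V'` are virtually cyclic. -/
lemma SatisfiesFIC.prod (hab : FICForVirtuallyAbelian ℋ 𝓕) (hpre : FICForPreimages ℋ 𝓕)
    {G G' : Type u} [Group G] [Group G'] (h : SatisfiesFIC ℋ 𝓕 G) (h' : SatisfiesFIC ℋ 𝓕 G') :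
    SatisfiesFIC ℋ 𝓕 (G × G') := by
  refine hpre _ _ (MonoidHom.fst G G') h fun V hV => ?_
  refine hpre _ _ ((MonoidHom.snd G G').comp (Subgroup.subtype _)) h' fun V' hV' => ?_
  refine (hab (V × V') (hV.virtuallyAbelian.prod hV'.virtuallyAbelian)).of_injective
    (MonoidHom.prod
      (((MonoidHom.fst G G').subgroupComap V).comp (Subgroup.subtype _))
      (((MonoidHom.snd G G').comp (Subgroup.subtype _)).subgroupComap V')) ?_
  intro x y hxy
  have h1 := congrArg (fun p => (p.1 : G)) hxy
  have h2 := congrArg (fun p => (p.2 : G')) hxy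
  exact Subtype.ext (Subtype.ext (Prod.ext h1 h2))

lemma SatisfiesFICwF.prod (hab : FICForVirtuallyAbelian ℋ 𝓕) (hpre : FICForPreimages ℋ 𝓕)
    {G G' : Type u} [Group G] [Group G'] (h : SatisfiesFICwF ℋ 𝓕 G)
    (h' : SatisfiesFICwF ℋ 𝓕 G') : SatisfiesFICwF ℋ 𝓕 (G × G') := fun H _ _ =>
  ((h H).prod hab hpre (h' H)).of_injective _ RegularWreathProduct.prodHom_injective

lemma SatisfiesFIC.of_subsingleton (hab : FICForVirtuallyAbelian ℋ 𝓕) (G : Type u) [Group G]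
    [Subsingleton G] : SatisfiesFIC ℋ 𝓕 G :=
  hab G ⟨⊤, inferInstance, ⟨⟨fun _ _ => Subsingleton.elim _ _⟩⟩⟩

lemma SatisfiesFIC.pi (hab : FICForVirtuallyAbelian ℋ 𝓕) (hpre : FICForPreimages ℋ 𝓕)
    {G : Type u} [Group G] (h : SatisfiesFIC ℋ 𝓕 G) (ι : Type u) [Finite ι] :
    SatisfiesFIC ℋ 𝓕 (ι → G) := by
  induction ι using Finite.induction_empty_option with
  | of_equiv e ih =>
    exact ih.of_injective (MonoidHom.pi fun i => Pi.evalMonoidHom _ (e i)) fun x y hxy =>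
      funext fun j => by
        have := congrFun hxy (e.symm j)
        change x (e (e.symm j)) = y (e (e.symm j)) at this
        rwa [e.apply_symm_apply] at this
  | h_empty => exact SatisfiesFIC.of_subsingleton hab _
  | h_option ih =>
    refine (h.prod hab hpre ih).of_injective ((Pi.evalMonoidHom _ none).prod
      (MonoidHom.pi fun i => Pi.evalMonoidHom _ (some i))) fun x y hxy => funext fun j => ?_
    cases j with
    | none => exact congrArg Prod.fst hxy
    | some j => exact congrFun (congrArg Prod.snd hxy) j

/-- A normal subgroup of finite index inside a power of the free group `F` puts `G` inside a power
of `F ≀ Q` with `Q` finite, and the conjecture passes to finite powers and subgroups. -/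
lemma VirtuallyFreePower.satisfiesFIC (hab : FICForVirtuallyAbelian ℋ 𝓕)
    (hpre : FICForPreimages ℋ 𝓕) (hF : SatisfiesFICwF ℋ 𝓕 (FreeGroup (ULift.{u} ℤ)))
    {G : Type u} [Group G] (h : VirtuallyFreePower G) : SatisfiesFIC ℋ 𝓕 G := by
  obtain ⟨N, hN, ι, hι, φ, hφ⟩ := h
  -- The extra coordinate `none`, sent to `1`, only serves to make the index set nonempty for
  -- `piHom_injective`.
  let φ' : N.normalCore →* (Option ι → FreeGroup (ULift.{u} ℤ)) :=
    MonoidHom.pi fun i => i.elim 1 fun i => (Pi.evalMonoidHom _ i).comp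
      (φ.comp (Subgroup.inclusion N.normalCore_le))
  have hφ' : Function.Injective φ' := by
    intro x y hxy
    apply Subgroup.inclusion_injective N.normalCore_le
    apply hφ
    funext i
    exact congrFun hxy (some i)
  -- With `C` the normal core, `Q = G ⧸ C` and `κ = Option ι`, the embeddings are `G → C ≀ Q → (κ →
  -- F) ≀ Q → (κ → F ≀ Q)`.
  refine ((hF (G ⧸ N.normalCore)).pi hab hpre (Option ι)).of_injective
    (((RegularWreathProduct.piHom _ _).comp (RegularWreathProduct.mapLeft _ φ')).comp
      (RegularWreathProduct.ofExtension N.normalCore)) ?_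
  exact ((RegularWreathProduct.piHom_injective _).comp
    (RegularWreathProduct.mapLeft_injective hφ')).comp (RegularWreathProduct.ofExtension_injective _)

/-- Preimages of virtually cyclic subgroups under a homomorphism of wreath products. -/
lemma VirtuallyFreePower.comap_mapLeft {L G H : Type u} [Group L] [Group G] [Group H] [Finite H]
    (p : L →* G) (hp : ∀ C : Subgroup G, IsCyclic C → VirtuallyFreePower (C.comap p))
    (V : Subgroup (G ≀ᵣ H)) (hV : VirtuallyCyclic V) :
    VirtuallyFreePower (V.comap (RegularWreathProduct.mapLeft H p)) := by
  obtain ⟨C, hC, hCc⟩ := hV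
  -- On elements with trivial component in `H` multiplication is coordinatewise, so each coordinate
  -- is a homomorphism on `B`, with cyclic image because `B` is cyclic.
  let B : Subgroup V := C ⊓ (RegularWreathProduct.rightHom.ker).comap V.subtype
  have : (RegularWreathProduct.rightHom.ker.comap V.subtype).FiniteIndex :=
    Subgroup.finiteIndex_comap _ (RegularWreathProduct.rightHom : G ≀ᵣ H →* H).ker
  have hB : B.FiniteIndex :=
    inferInstanceAs (C ⊓ RegularWreathProduct.rightHom.ker.comap V.subtype).FiniteIndex
  have hBC : B ≤ C := inf_le_left
  have hBr : ∀ x ∈ B, x.1.right = 1 := fun x hx => hx.2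
  have hBc : IsCyclic B := isCyclic_of_injective (Subgroup.inclusion hBC)
    (Subgroup.inclusion_injective hBC)
  let ev : H → B →* G := fun q =>
    { toFun := fun x => x.1.1.left q
      map_one' := rfl
      map_mul' := fun x y => by simp [hBr x.1 x.2] }
  let ψ := (RegularWreathProduct.mapLeft H p).subgroupComap V
  have : (B.comap ψ).FiniteIndex := B.finiteIndex_comap ψ
  refine VirtuallyFreePower.of_finiteIndex (B.comap ψ) ?_
  have hright : ∀ x : B.comap ψ, x.1.1.right = 1 := fun x => hBr _ x.2
  -- The `q`-th coordinate of an element over `B` lies in the preimage under `p` of the cyclic group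
  -- `(ev q).range`.
  refine VirtuallyFreePower.of_injective (G' := ∀ q : H, (ev q).range.comap p)
    (MonoidHom.pi fun q =>
      { toFun := fun x => ⟨x.1.1.left q, ⟨⟨ψ x.1, x.2⟩, rfl⟩⟩
        map_one' := rfl
        map_mul' := fun x y => Subtype.ext (by simp [hright x]) }) ?_
    (VirtuallyFreePower.pi fun q => hp _
      (isCyclic_of_surjective (ev q).rangeRestrict (ev q).rangeRestrict_surjective))
  intro x y hxy
  ext q
  · exact congrArg Subtype.val (congrFun hxy q)
  · rw [hright, hright]

/-- Cyclic subgroups of `G` suffice in the hypothesis: passing to finite index absorbs both the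
finite group `H` and the difference between cyclic and virtually cyclic. -/
lemma SatisfiesFICwF.of_comap_cyclic (hab : FICForVirtuallyAbelian ℋ 𝓕)
    (hpre : FICForPreimages ℋ 𝓕) (hF : SatisfiesFICwF ℋ 𝓕 (FreeGroup (ULift.{u} ℤ)))
    {L G : Type u} [Group L] [Group G] (h : SatisfiesFICwF ℋ 𝓕 G) (p : L →* G)
    (hp : ∀ C : Subgroup G, IsCyclic C → VirtuallyFreePower (C.comap p)) :
    SatisfiesFICwF ℋ 𝓕 L := fun H _ _ =>
  hpre _ _ (RegularWreathProduct.mapLeft H p) (h H) fun V hV =>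
    (VirtuallyFreePower.comap_mapLeft p hp V hV).satisfiesFIC hab hpre hF

end FIC

/-! ### Free action groupoids -/

section Cocycles

variable {G' G X : Type u} [Group G'] [Group G] [MulAction G X]

/-- `c : G' → X → A` is a cocycle, i.e. a functor from the action groupoid of `G'` on `X` (through
`j : G' → G`) to `A`; the value `c g x` is that of the arrow `g : g⁻¹ • x → x`. -/
def IsCocycle (j : G' →* G) {A : Type u} [Group A] (c : G' → X → A) : Prop :=
  ∀ g h x, c (g * h) x = c g x * c h ((j g)⁻¹ • x)

lemma IsCocycle.map_one {j : G' →* G} {A : Type u} [Group A] {c : G' → X → A}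
    (hc : IsCocycle j c) (x : X) : c 1 x = 1 := by
  have := hc 1 1 x
  simpa using this

/-- The action groupoid of `G'` on `X` (through `j : G' → G`) is freely generated by a family
of arrows. -/
def HasFreeCocycles (j : G' →* G) (X : Type u) [MulAction G X] : Prop :=
  ∃ (ι : Type u) (g : ι → G') (t : ι → X), ∀ (A : Type u) [Group A] (f : ι → A),
    ∃! c : G' → X → A, IsCocycle j c ∧ ∀ i, c (g i) (t i) = f i

open Classical in
/-- The action groupoid is free if all stabilizers are free. -/
theorem hasFreeCocycles_of_stabilizer (j : G' →* G)
    (hfree : ∀ x : X, IsFreeGroup ((MulAction.stabilizer G x).comap j)) :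
    HasFreeCocycles j X := by
  let _ : MulAction G' X := MulAction.compHom X j
  have smul_def : ∀ (g : G') (x : X), j g • x = g • x := fun _ _ => rfl
  let Ω := MulAction.orbitRel.Quotient G' X
  let π : X → Ω := Quotient.mk _
  have hπ : ∀ (g : G') x, π (g • x) = π x := fun g x => Quotient.sound ⟨g, rfl⟩
  let r : Ω → X := Quotient.out
  have hr : ∀ o, π (r o) = o := Quotient.out_eq
  -- A spanning star in each orbit: `τ x` is an arrow from the base point of the orbit to `x`,
  -- normalized to `1` at the base point itself.
  have hex : ∀ x, ∃ g : G', g • r (π x) = x ∧ (x = r (π x) → g = 1) := by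
    intro x
    by_cases h : x = r (π x)
    · exact ⟨1, by rw [one_smul, ← h], fun _ => rfl⟩
    · obtain ⟨g, hg⟩ := Quotient.exact (hr (π x)).symm
      exact ⟨g, hg, fun h' => absurd h' h⟩
  choose τ hτ hτ1 using hex
  have hτi : ∀ x, (τ x)⁻¹ • x = r (π x) := fun x => by
    rw [inv_smul_eq_iff, hτ]
  let S : Ω → Subgroup G' := fun o => (MulAction.stabilizer G (r o)).comap j
  have hS : ∀ o k, k ∈ S o ↔ k • r o = r o := fun o k => Iff.rfl
  -- Any arrow `g : g⁻¹ • y → y` becomes a loop at the base point after composition with the star.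
  have hSmem : ∀ g y, (τ y)⁻¹ * g * τ (g⁻¹ • y) ∈ S (π y) := by
    intro g y
    rw [hS, mul_smul, mul_smul]
    nth_rewrite 1 [← hπ g⁻¹ y]
    rw [hτ, smul_inv_smul, hτi]
  -- The free generators are the nontrivial arrows of the stars together with free generators of the
  -- vertex group at each base point.
  let ι := {x : X // x ≠ r (π x)} ⊕ Σ o, IsFreeGroup.Generators (S o)
  refine ⟨ι, Sum.elim (fun x => τ x.1) (fun p => (IsFreeGroup.of p.2 : S p.1)),
    Sum.elim (fun x => x.1) (fun p => r p.1), fun A _ f => ?_⟩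
  let b : X → A := fun x => if h : x = r (π x) then 1 else f (Sum.inl ⟨x, h⟩)
  let θ : ∀ o, S o →* A := fun o => IsFreeGroup.lift fun s => f (Sum.inr ⟨o, s⟩)
  let Θ : Ω → G' → A := fun o k => if h : k ∈ S o then θ o ⟨k, h⟩ else 1
  have hΘ : ∀ o k (h : k ∈ S o), Θ o k = θ o ⟨k, h⟩ := fun o k h => dif_pos h
  have hΘmul : ∀ o k k', k ∈ S o → k' ∈ S o → Θ o (k * k') = Θ o k * Θ o k' := by
    intro o k k' hk hk'
    rw [hΘ _ _ hk, hΘ _ _ hk', hΘ _ _ ((S o).mul_mem hk hk'), ← _root_.map_mul]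
    rfl
  have hb : ∀ o, b (r o) = 1 := fun o => dif_pos (by rw [hr])
  have hτr : ∀ o, τ (r o) = 1 := fun o => hτ1 _ (by rw [hr])
  -- The value is forced by factoring `g` as star arrow, loop at the base point, inverse star arrow.
  -- The loop parts of a product telescope, which is the cocycle identity.
  refine ⟨fun g y => b y * Θ (π y) ((τ y)⁻¹ * g * τ (g⁻¹ • y)) * (b (g⁻¹ • y))⁻¹, ⟨?_, ?_⟩, ?_⟩
  · intro g h y
    simp only [← map_inv, smul_def]
    have h1 := hSmem g y
    have h2 := hSmem h (g⁻¹ • y)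
    rw [hπ] at h2 ⊢
    have key : (τ y)⁻¹ * (g * h) * τ ((g * h)⁻¹ • y)
        = ((τ y)⁻¹ * g * τ (g⁻¹ • y)) * ((τ (g⁻¹ • y))⁻¹ * h * τ (h⁻¹ • g⁻¹ • y)) := by
      rw [mul_inv_rev, mul_smul]
      group
    rw [key, hΘmul _ _ _ h1 h2, mul_inv_rev, mul_smul]
    group
  · rintro (⟨x, hx⟩ | ⟨o, s⟩)
    · simp only [Sum.elim_inl]
      rw [hτi, hb, hτr]
      have h1 : b x = f (Sum.inl ⟨x, hx⟩) := dif_neg hx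
      have h2 : Θ (π x) ((τ x)⁻¹ * τ x * 1) = 1 := by
        rw [hΘ _ _ (by simp)]
        convert (θ (π x)).map_one
        simp
      rw [h1, h2]
      simp
    · simp only [Sum.elim_inr]
      have h0 : ((IsFreeGroup.of s : S o) : G')⁻¹ • r o = r o := by
        rw [inv_smul_eq_iff]
        exact ((hS _ _).1 (IsFreeGroup.of s : S o).2).symm
      rw [h0, hb, hτr, hr, hΘ o _ (by simp)]
      have : (⟨1⁻¹ * ((IsFreeGroup.of s : S o) : G') * 1, by simp⟩ : S o) = IsFreeGroup.of s :=
        Subtype.ext (by simp)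
      rw [this]
      simp [θ]
  · rintro c ⟨hc, hcf⟩
    have hcτ : ∀ x, c (τ x) x = b x := by
      intro x
      by_cases h : x = r (π x)
      · rw [hτ1 x h, hc.map_one]
        simp only [b, dif_pos h]
      · refine (hcf (Sum.inl ⟨x, h⟩)).trans ?_
        simp only [b, dif_neg h]
    have hcS : ∀ o (k : S o), c k (r o) = θ o k := by
      intro o
      let θ' : S o →* A :=
        { toFun := fun k => c k (r o)
          map_one' := hc.map_one _
          map_mul' := fun k k' => by
            have h0 : (j k)⁻¹ • r o = r o := by
              rw [inv_smul_eq_iff]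
              exact ((hS _ _).1 k.2).symm
            have := hc k k' (r o)
            rwa [h0] at this }
      have : θ' = θ o := by
        refine IsFreeGroup.ext_hom fun s => ?_
        rw [show θ o (IsFreeGroup.of s) = f (Sum.inr ⟨o, s⟩) by simp [θ]]
        exact hcf (Sum.inr ⟨o, s⟩)
      exact fun k => DFunLike.congr_fun this k
    funext g y
    -- Uniqueness: the element `g τ(g⁻¹y)` is also `τ(y)` times a loop, and comparing the two
    -- expansions of `c` determines `c g y`.
    have h1 := hc g (τ (g⁻¹ • y)) y
    have h2 := hc (τ y) ((τ y)⁻¹ * g * τ (g⁻¹ • y)) y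
    rw [← map_inv, smul_def, hcτ] at h1 h2
    rw [hτi, hcS _ ⟨_, hSmem g y⟩, ← hΘ] at h2
    rw [← h2, eq_mul_inv_iff_mul_eq, ← h1]
    congr 1
    group

/-- The homomorphism to a semidirect product given by a cocycle. -/
def IsCocycle.toHom {j : G' →* G} {A : Type u} [Group A] {c : G' → X → A} (hc : IsCocycle j c) :
    G' →* (X → A) ⋊[mulAutArrow] G where
  toFun g := ⟨c g, j g⟩
  map_one' := by
    ext x
    · exact hc.map_one x
    · exact _root_.map_one j
  map_mul' g h := by
    ext x
    · exact hc g h x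
    · exact map_mul j g h

/-- Converse of `IsCocycle.toHom`: the first component of multiplication in the semidirect product
is exactly the cocycle identity. -/
lemma isCocycle_left {j : G' →* G} {A : Type u} [Group A] (φ : G' →* (X → A) ⋊[mulAutArrow] G)
    (hφ : ∀ g, (φ g).right = j g) : IsCocycle j fun g => (φ g).left := by
  intro g h x
  have := congrArg (fun p => p.left x) (φ.map_mul g h)
  dsimp only at this ⊢
  rw [this, ← hφ]
  rfl

/-- The action groupoid of a free product is free if those of the factors are. -/
theorem HasFreeCocycles.coprod {G₁ G₂ : Type u} [Group G₁] [Group G₂]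
    [MulAction (Monoid.Coprod G₁ G₂) X]
    (h₁ : HasFreeCocycles (Monoid.Coprod.inl : G₁ →* Monoid.Coprod G₁ G₂) X)
    (h₂ : HasFreeCocycles (Monoid.Coprod.inr : G₂ →* Monoid.Coprod G₁ G₂) X) :
    HasFreeCocycles (MonoidHom.id (Monoid.Coprod G₁ G₂)) X := by
  obtain ⟨ι₁, g₁, t₁, h₁⟩ := h₁
  obtain ⟨ι₂, g₂, t₂, h₂⟩ := h₂
  refine ⟨ι₁ ⊕ ι₂, Sum.elim (fun i => Monoid.Coprod.inl (g₁ i)) fun i => Monoid.Coprod.inr (g₂ i),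
    Sum.elim t₁ t₂, fun A _ f => ?_⟩
  obtain ⟨c₁, ⟨hc₁, hf₁⟩, hu₁⟩ := h₁ A fun i => f (Sum.inl i)
  obtain ⟨c₂, ⟨hc₂, hf₂⟩, hu₂⟩ := h₂ A fun i => f (Sum.inr i)
  -- Cocycles are lifts of the identity to the semidirect product, so cocycles on the two factors
  -- glue by the universal property of the free product.
  let φ : Monoid.Coprod G₁ G₂ →* (X → A) ⋊[mulAutArrow] Monoid.Coprod G₁ G₂ :=
    Monoid.Coprod.lift hc₁.toHom hc₂.toHom
  have hφ : ∀ g, (φ g).right = MonoidHom.id _ g := by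
    have : SemidirectProduct.rightHom.comp φ = MonoidHom.id _ :=
      Monoid.Coprod.hom_ext (MonoidHom.ext fun _ => rfl) (MonoidHom.ext fun _ => rfl)
    exact fun g => DFunLike.congr_fun this g
  refine ⟨fun g => (φ g).left, ⟨isCocycle_left φ hφ, ?_⟩, ?_⟩
  · rintro (i | i)
    · exact hf₁ i
    · exact hf₂ i
  · rintro c ⟨hc, hcf⟩
    have e₁ : (fun g => c (Monoid.Coprod.inl g)) = c₁ :=
      hu₁ _ ⟨fun g h x => by simpa using hc _ _ x, fun i => hcf (Sum.inl i)⟩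
    have e₂ : (fun g => c (Monoid.Coprod.inr g)) = c₂ :=
      hu₂ _ ⟨fun g h x => by simpa using hc _ _ x, fun i => hcf (Sum.inr i)⟩
    have : hc.toHom = φ := by
      refine Monoid.Coprod.hom_ext (MonoidHom.ext fun g => ?_) (MonoidHom.ext fun g => ?_)
      · exact SemidirectProduct.ext (congrFun e₁ g) rfl
      · exact SemidirectProduct.ext (congrFun e₂ g) rfl
    funext g
    exact congrArg SemidirectProduct.left (DFunLike.congr_fun this g)

/-- The functor given by a cocycle. -/
def IsCocycle.toFunctor {A : Type u} [Group A] {c : G → X → A}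
    (hc : IsCocycle (MonoidHom.id G) c) : ActionCategory G X ⥤ SingleObj A where
  obj _ := SingleObj.star A
  map {_ b} f := (c f.val b.back : A)
  map_id _ := hc.map_one _
  map_comp {a b d} f g := by
    have h : g.val⁻¹ • d.back = b.back := by
      rw [inv_smul_eq_iff]
      exact g.2.symm
    have := hc g.val f.val d.back
    rw [MonoidHom.id_apply, h] at this
    exact this

lemma isCocycle_map {A : Type u} [Group A] (F : ActionCategory G X ⥤ SingleObj A) :
    IsCocycle (MonoidHom.id G)
      fun g x => (F.map (ActionCategory.homOfPair x g) : A) :=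
  isCocycle_left (ActionCategory.curry F) fun _ => rfl

/-- An arrow of the action category is recovered from its target and its group element, so a functor
is determined by its associated cocycle. -/
lemma map_homOfPair {A : Type u} [Group A] (F : ActionCategory G X ⥤ SingleObj A)
    {a b : ActionCategory G X} (f : a ⟶ b) :
    (F.map f : A) = F.map (ActionCategory.homOfPair b.back f.val) := by
  induction f using ActionCategory.cases with
  | hyp t g => rfl

/-- The free groupoid structure on an action groupoid. -/
theorem HasFreeCocycles.nonempty_isFreeGroupoid (h : HasFreeCocycles (MonoidHom.id G) X) :
    Nonempty (IsFreeGroupoid (ActionCategory G X)) := by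
  obtain ⟨ι, g, t, h⟩ := h
  refine ⟨{
    -- The generator `i` occurs only from `(g i)⁻¹ • t i` to `t i`.
    quiverGenerators := ⟨fun (a b : ActionCategory G X) =>
      { i : ι // g i • a.back = b.back ∧ t i = b.back }⟩
    of := fun i => ⟨g i.1, i.2.1⟩
    unique_lift := ?_ }⟩
  intro A _ f
  obtain ⟨c, ⟨hc, hcf⟩, hu⟩ := h A fun i =>
    f (a := (⟨(), (g i)⁻¹ • t i⟩ : ActionCategory G X)) (b := (⟨(), t i⟩ : ActionCategory G X))
      ⟨i, smul_inv_smul _ _, rfl⟩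
  refine ⟨hc.toFunctor, ?_, ?_⟩
  · rintro ⟨⟨⟩, a : X⟩ ⟨⟨⟩, b : X⟩ ⟨i, h1 : g i • a = b, h2 : t i = b⟩
    subst h2
    obtain rfl : a = (g i)⁻¹ • t i := by rw [← h1, inv_smul_smul]
    exact hcf i
  · intro F hF
    have : (fun g x => (F.map (ActionCategory.homOfPair x g) : A)) = c :=
      hu _ ⟨isCocycle_map F, fun i => hF (⟨(), (g i)⁻¹ • t i⟩ : ActionCategory G X)
        (⟨(), t i⟩ : ActionCategory G X) ⟨i, smul_inv_smul _ _, rfl⟩⟩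
    refine Functor.hext (fun _ => Subsingleton.elim _ _) fun a b e => heq_of_eq ?_
    refine (map_homOfPair F e).trans ?_
    exact congrFun (congrFun this e.val) b.back

/-- A subgroup of `G` is free if the action groupoid of `G` on its cosets is free. -/
theorem HasFreeCocycles.isFreeGroup {L : Subgroup G}
    (h : HasFreeCocycles (MonoidHom.id G) (G ⧸ L)) : IsFreeGroup L := by
  obtain ⟨inst⟩ := h.nonempty_isFreeGroupoid
  let r : ActionCategory G (G ⧸ L) := ActionCategory.objEquiv G (G ⧸ L) ↑(1 : G)
  let K : Groupoid (ActionCategory G (G ⧸ L)) := inferInstance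
  have hc : @IsConnected _ K.toCategory :=
    inferInstanceAs (IsConnected (ActionCategory G (G ⧸ L)))
  -- The groupoid form of the Nielsen-Schreier theorem; the vertex group at the trivial coset is its
  -- stabilizer `L`.
  have hE : @IsFreeGroup (@End _ K.toCategory.toCategoryStruct r) _ :=
    @IsFreeGroupoid.endIsFreeOfConnectedFree _ K hc inst r
  let e : @End _ K.toCategory.toCategoryStruct r ≃ L :=
    (ActionCategory.endMulEquivSubgroup L).toEquiv
  exact IsFreeGroup.ofMulEquiv (G := @End _ K.toCategory.toCategoryStruct r)
    { toEquiv := e, map_mul' := fun a b => (ActionCategory.endMulEquivSubgroup L).map_mul' a b }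

end Cocycles

/-- Nielsen-Schreier, applied to the range of `f`. -/
lemma IsFreeGroup.of_injective {L G : Type u} [Group L] [Group G] [IsFreeGroup G] (f : L →* G)
    (hf : Function.Injective f) : IsFreeGroup L :=
  IsFreeGroup.ofMulEquiv (MonoidHom.ofInjective hf).symm

/-- The preimage in `G₁ * G₂` of a free subgroup of `G₁ × G₂` is free. -/
theorem isFreeGroup_comap_toProd {G₁ G₂ : Type u} [Group G₁] [Group G₂] (D : Subgroup (G₁ × G₂))
    [IsFreeGroup D] :
    IsFreeGroup (D.comap (Monoid.Coprod.toProd : Monoid.Coprod G₁ G₂ →* G₁ × G₂)) := by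
  -- Both factors satisfy the hypothesis on `j`, since the canonical map is injective on them.
  have key : ∀ {G' : Type u} [Group G'] (j : G' →* Monoid.Coprod G₁ G₂),
      Function.Injective (Monoid.Coprod.toProd.comp j) →
      HasFreeCocycles j (Monoid.Coprod G₁ G₂ ⧸ D.comap Monoid.Coprod.toProd) := by
    intro G' _ j hj
    refine hasFreeCocycles_of_stabilizer j fun x => ?_
    obtain ⟨y, rfl⟩ := QuotientGroup.mk_surjective x
    -- The stabilizer of the coset of `y` is the conjugate of the preimage of `D` by `y`;
    -- conjugating back in `G₁ × G₂` moves its image into `D`.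
    let f : G' →* G₁ × G₂ := (MulAut.conj (Monoid.Coprod.toProd y)⁻¹).toMonoidHom.comp
      (Monoid.Coprod.toProd.comp j)
    have hf : Function.Injective f := (MulAut.conj _).injective.comp hj
    have hmem : ∀ g ∈ (MulAction.stabilizer (Monoid.Coprod G₁ G₂)
        (y : Monoid.Coprod G₁ G₂ ⧸ D.comap Monoid.Coprod.toProd)).comap j, f g ∈ D := by
      intro g hg
      have h1 := (QuotientGroup.eq (s := D.comap Monoid.Coprod.toProd) (a := j g * y)
        (b := y)).1 hg
      have h2 := D.inv_mem h1
      simpa [f, mul_assoc] using h2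
    refine IsFreeGroup.of_injective ((f.comp (Subgroup.subtype _)).codRestrict D
      fun g => hmem g.1 g.2) fun a b hab => Subtype.ext (hf (congrArg Subtype.val hab))
  exact ((key Monoid.Coprod.inl fun a b h => congrArg Prod.fst h).coprod
    (key Monoid.Coprod.inr fun a b h => congrArg Prod.snd h)).isFreeGroup

/-! ### Virtually cyclic groups and preimages in free products -/

/-- A finite group contains the trivial group, free of rank zero, with finite index; an infinite
cyclic group is itself free of rank one. -/
lemma IsCyclic.exists_finiteIndex_isFreeGroup (C : Type u) [Group C] [IsCyclic C] :
    ∃ D : Subgroup C, D.FiniteIndex ∧ IsFreeGroup D := by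
  cases finite_or_infinite C
  · refine ⟨⊥, inferInstance, ?_⟩
    exact IsFreeGroup.of_injective (G := FreeGroup PEmpty.{u + 1}) 1
      fun _ _ _ => Subsingleton.elim _ _
  · refine ⟨⊤, inferInstance, ?_⟩
    obtain ⟨g, hg⟩ := IsCyclic.exists_generator (α := C)
    have hg' : Subgroup.zpowers g = ⊤ := eq_top_iff.2 fun x _ => hg x
    have e := intEquivOfZPowersEqTop_symm_self hg'
    have : IsFreeGroup C := by
      refine IsFreeGroup.ofUniqueLift PUnit.{u + 1} (fun _ => g) fun {A} _ f => ?_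
      refine ⟨(zpowersHom A (f PUnit.unit)).comp (intEquivOfZPowersEqTop g hg').symm.toMonoidHom,
        fun _ => by simp [e], fun F hF => MonoidHom.ext fun x => ?_⟩
      obtain ⟨n, rfl⟩ := hg x
      simp [e, hF PUnit.unit]
    exact IsFreeGroup.of_injective (Subgroup.subtype _) (Subgroup.subtype_injective _)

lemma exists_finiteIndex_isFreeGroup_comap {G₁ G₂ : Type u} [Group G₁] [Group G₂]
    (V : Subgroup (G₁ × G₂)) (hV : VirtuallyCyclic V) :
    ∃ N : Subgroup (V.comap (Monoid.Coprod.toProd : Monoid.Coprod G₁ G₂ →* G₁ × G₂)),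
      N.FiniteIndex ∧ IsFreeGroup N := by
  obtain ⟨C, hC, hCc⟩ := hV
  obtain ⟨D, hD, hDf⟩ := IsCyclic.exists_finiteIndex_isFreeGroup C
  let D' : Subgroup V := D.map C.subtype
  have hD' : D'.FiniteIndex := ⟨by
    rw [Subgroup.index_map_subtype]
    exact mul_ne_zero hD.index_ne_zero hC.index_ne_zero⟩
  let E : Subgroup (G₁ × G₂) := D'.map V.subtype
  have hE : IsFreeGroup E := IsFreeGroup.ofMulEquiv
    ((D.equivMapOfInjective C.subtype C.subtype_injective).trans
      (D'.equivMapOfInjective V.subtype V.subtype_injective))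
  have := isFreeGroup_comap_toProd E
  let p : Monoid.Coprod G₁ G₂ →* G₁ × G₂ := Monoid.Coprod.toProd
  refine ⟨D'.comap (p.subgroupComap V), D'.finiteIndex_comap _, ?_⟩
  refine IsFreeGroup.of_injective (G := E.comap p)
    (((V.comap p).subtype.comp (Subgroup.subtype _)).codRestrict _
      fun x => ⟨_, x.2, rfl⟩) fun a b h => ?_
  have h1 := congrArg Subtype.val h
  exact Subtype.ext (Subtype.ext h1)

/-- Virtually free countable groups. -/
lemma exists_freeGroup_equiv_of_countable (G : Type u) [Group G] [Countable G] [IsFreeGroup G] :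
    ∃ (S : Type) (_ : Countable S), Nonempty (G ≃* FreeGroup S) := by
  have e := IsFreeGroup.toFreeGroup G
  have hc : Countable (IsFreeGroup.Generators G) :=
    (IsFreeGroup.basis G).injective.countable
  -- Replacing the generators by a subset of `ℕ` brings the basis into universe zero.
  obtain ⟨f, hf⟩ := exists_injective_nat (IsFreeGroup.Generators G)
  exact ⟨range f, inferInstance, ⟨e.trans (FreeGroup.freeGroupCongr (Equiv.ofInjective f hf))⟩⟩

instance Monoid.Coprod.countable {G₁ G₂ : Type u} [Group G₁] [Group G₂] [Countable G₁]
    [Countable G₂] : Countable (Monoid.Coprod G₁ G₂) :=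
  haveI : Countable (FreeMonoid (G₁ ⊕ G₂)) := inferInstanceAs (Countable (List (G₁ ⊕ G₂)))
  Monoid.Coprod.mk_surjective.countable

/-- Preimages of virtually cyclic subgroups in a free product embed into a wreath product of a
countable free group with a finite group. -/
theorem exists_embedding_wreathProduct_of_comap_toProd {G₁ G₂ : Type u} [Group G₁] [Group G₂]
    [Countable G₁] [Countable G₂] (V : Subgroup (G₁ × G₂)) (hV : VirtuallyCyclic V) :
    ∃ (S : Type) (H : Type u) (_ : Group H), Countable S ∧ Finite H ∧
      ∃ e : V.comap (Monoid.Coprod.toProd : Monoid.Coprod G₁ G₂ →* G₁ × G₂) →*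
        FreeGroup S ≀ᵣ H, Function.Injective e := by
  obtain ⟨N, hN, hNf⟩ := exists_finiteIndex_isFreeGroup_comap V hV
  have : IsFreeGroup N.normalCore := IsFreeGroup.of_injective
    (Subgroup.inclusion N.normalCore_le) (Subgroup.inclusion_injective _)
  obtain ⟨S, hS, ⟨e⟩⟩ := exists_freeGroup_equiv_of_countable N.normalCore
  exact ⟨S, _ ⧸ N.normalCore, inferInstance, hS, inferInstance,
    (RegularWreathProduct.mapLeft _ e.toMonoidHom).comp
      (RegularWreathProduct.ofExtension N.normalCore),
    (RegularWreathProduct.mapLeft_injective e.injective).comp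
      (RegularWreathProduct.ofExtension_injective _)⟩

/-- A countable free group embeds into the free group on `ℤ`. -/
lemma exists_embedding_freeGroup_int (S : Type) [Countable S] :
    ∃ f : FreeGroup S →* FreeGroup (ULift.{u} ℤ), Function.Injective f := by
  obtain ⟨f, hf⟩ := exists_injective_nat S
  exact ⟨FreeGroup.map fun s => ULift.up (f s : ℤ), FreeGroup.map_injective fun a b h =>
    hf (Nat.cast_injective (congrArg ULift.down h))⟩

lemma virtuallyFreePower_comap_toProd {G₁ G₂ : Type u} [Group G₁] [Group G₂]
    [Countable G₁] [Countable G₂] (C : Subgroup (G₁ × G₂)) (hC : IsCyclic C) :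
    VirtuallyFreePower (C.comap (Monoid.Coprod.toProd : Monoid.Coprod G₁ G₂ →* G₁ × G₂)) := by
  obtain ⟨N, hN, hNf⟩ := exists_finiteIndex_isFreeGroup_comap C ⟨⊤, inferInstance,
    isCyclic_of_injective (Subgroup.subtype ⊤) (Subgroup.subtype_injective _)⟩
  obtain ⟨S, hS, ⟨e⟩⟩ := exists_freeGroup_equiv_of_countable N
  obtain ⟨f, hf⟩ := exists_embedding_freeGroup_int.{u} S
  exact VirtuallyFreePower.of_finiteIndex N
    (VirtuallyFreePower.of_embedding (f.comp e.toMonoidHom) (hf.comp e.injective))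

/-- The automorphisms of the free group on `ℤ` given by translations. -/
def FreeGroup.shift : Multiplicative ℤ →* MulAut (FreeGroup (ULift.{u} ℤ)) where
  toFun n := FreeGroup.freeGroupCongr
    (Equiv.ulift.trans ((Equiv.addLeft n.toAdd).trans Equiv.ulift.symm))
  map_one' := by
    ext x
    induction x using FreeGroup.induction_on with
    | C1 => simp
    | of i => simp
    | inv_of i _ => simp
    | mul x y hx hy => simp_all
  map_mul' m n := by
    ext x
    induction x using FreeGroup.induction_on with
    | C1 => simp
    | of i => simp [add_assoc]
    | inv_of i _ => simp [add_assoc]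
    | mul x y hx hy => simp_all

/-- The free group of rank two contains a free group of infinite rank. -/
lemma exists_embedding_freeGroup_bool :
    ∃ f : FreeGroup (ULift.{u} ℤ) →* FreeGroup Bool, Function.Injective f := by
  let f : FreeGroup (ULift.{u} ℤ) →* FreeGroup Bool := FreeGroup.lift fun n =>
    FreeGroup.of true ^ n.down * FreeGroup.of false * (FreeGroup.of true ^ n.down)⁻¹
  -- With `a`, `b` the generators `true`, `false`, the map `f` sends `xₙ` to `aⁿ b a⁻ⁿ`. Sending `a`
  -- to the unit translation and `b` to `x₀` turns this conjugate back into `xₙ`, so `ψ ∘ f` is the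
  -- injective `inl`.
  let ψ : FreeGroup Bool →* FreeGroup (ULift.{u} ℤ) ⋊[FreeGroup.shift] Multiplicative ℤ :=
    FreeGroup.lift fun b => cond b (SemidirectProduct.inr (Multiplicative.ofAdd 1))
      (SemidirectProduct.inl (FreeGroup.of ⟨0⟩))
  have h : ψ.comp f = SemidirectProduct.inl := by
    ext1 n
    simp only [f, ψ, MonoidHom.comp_apply, FreeGroup.lift_apply_of, map_mul, map_zpow, map_inv,
      cond_true, cond_false]
    rw [← map_zpow, ← map_inv, ← SemidirectProduct.inl_aut]
    congr 1
    simp [FreeGroup.shift]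
  refine ⟨f, Function.Injective.of_comp (f := ψ) ?_⟩
  rw [← MonoidHom.coe_comp, h]
  exact SemidirectProduct.inl_injective

/-! ### Conformally flat Riemannian metrics given by a function on the charts -/

section ConformalMetric

variable {n : ℕ} {M : Type u} [TopologicalSpace M] [ChartedSpace (EuclideanSpace ℝ (Fin n)) M]

local notation "𝔼" => EuclideanSpace ℝ (Fin n)

/-- The transition maps of `M` are isometries for the metric `lam • ⟪·, ·⟫`. -/
structure IsConformalFactor (M : Type u) [TopologicalSpace M]
    [ChartedSpace (EuclideanSpace ℝ (Fin n)) M] (lam : EuclideanSpace ℝ (Fin n) → ℝ) : Prop where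
  pos : ∀ (x : M), ∀ y ∈ (chartAt 𝔼 x).target, 0 < lam y
  contDiffOn : ∀ x : M, ContDiffOn ℝ ∞ lam (chartAt 𝔼 x).target
  inner_fderiv : ∀ (x x' : M), ∀ y ∈ ((chartAt 𝔼 x).symm ≫ₕ chartAt 𝔼 x').source, ∀ v w : 𝔼,
    lam (chartAt 𝔼 x' ((chartAt 𝔼 x).symm y)) *
      inner ℝ (fderiv ℝ (chartAt 𝔼 x' ∘ (chartAt 𝔼 x).symm) y v)
        (fderiv ℝ (chartAt 𝔼 x' ∘ (chartAt 𝔼 x).symm) y w) = lam y * inner ℝ v w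

lemma fderivWithin_extChartAt_comp (x x' : M) (y : 𝔼) :
    fderivWithin ℝ (extChartAt (𝓡 n) x' ∘ (extChartAt (𝓡 n) x).symm) (range (𝓡 n)) y =
      fderiv ℝ (chartAt 𝔼 x' ∘ (chartAt 𝔼 x).symm) y := by
  have h : (extChartAt (𝓡 n) x' ∘ (extChartAt (𝓡 n) x).symm) =
      chartAt 𝔼 x' ∘ (chartAt 𝔼 x).symm := by
    ext z
    simp [mfld_simps]
  rw [h, show range (𝓡 n) = univ by simp [mfld_simps], fderivWithin_univ]

/-- The tangent space at a point is identified with `𝔼` by the preferred chart at that point, so the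
derivative of an inverse chart is that of a transition map. -/
lemma mfderiv_extChartAt_symm_eq [IsManifold (𝓡 n) ∞ M] (x : M) {y : 𝔼}
    (hy : y ∈ (chartAt 𝔼 x).target) (v : 𝔼) :
    (mfderiv 𝓘(ℝ, 𝔼) (𝓡 n) (extChartAt (𝓡 n) x).symm y v : 𝔼) =
      fderiv ℝ (chartAt 𝔼 ((extChartAt (𝓡 n) x).symm y) ∘ (chartAt 𝔼 x).symm) y v := by
  have hd : MDifferentiableAt 𝓘(ℝ, 𝔼) (𝓡 n) (extChartAt (𝓡 n) x).symm y := by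
    have h1 := contMDiffOn_extChartAt_symm (I := 𝓡 n) (n := ∞) x
    have h2 : (extChartAt (𝓡 n) x).target ∈ 𝓝 y := by
      rw [show (extChartAt (𝓡 n) x).target = (chartAt 𝔼 x).target by simp [mfld_simps]]
      exact (chartAt 𝔼 x).open_target.mem_nhds hy
    exact (h1.contMDiffAt h2).mdifferentiableAt (by simp)
  rw [← fderivWithin_extChartAt_comp x ((extChartAt (𝓡 n) x).symm y) y]
  exact congrArg (fun f : 𝔼 →L[ℝ] 𝔼 => f v) hd.mfderiv

variable [IsManifold (𝓡 n) ∞ M] {lam : EuclideanSpace ℝ (Fin n) → ℝ}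

open Bundle in
/-- The Riemannian metric `lam • ⟪·, ·⟫`. -/
noncomputable def IsConformalFactor.metric (h : IsConformalFactor M lam) :
    Bundle.ContMDiffRiemannianMetric (𝓡 n) ∞ (EuclideanSpace ℝ (Fin n))
      (fun p : M => TangentSpace (𝓡 n) p) where
  -- The factor is evaluated in the preferred chart at `b`, the one that identifies the tangent
  -- space at `b` with `𝔼`.
  inner b := lam (chartAt 𝔼 b b) • (show 𝔼 →L[ℝ] 𝔼 →L[ℝ] ℝ from innerSL ℝ)
  symm b v w := congrArg (lam (chartAt 𝔼 b b) * ·) (real_inner_comm (F := 𝔼) w v)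
  pos b v hv := mul_pos (h.pos b _ (mem_chart_target _ b)) (real_inner_self_pos (F := 𝔼) |>.2 hv)
  isVonNBounded b := by
    have hp := h.pos b _ (mem_chart_target _ b)
    refine (NormedSpace.isVonNBounded_iff ℝ (E := 𝔼)).2 ?_
    -- The bound `‖v‖² < μ` gives `‖v‖ < 1 + μ`, without a square root.
    refine (Metric.isBounded_ball (x := (0 : 𝔼)) (r := 1 + (lam (chartAt 𝔼 b b))⁻¹)).subset ?_
    intro v (hv : lam (chartAt 𝔼 b b) * inner ℝ (v : 𝔼) v < 1)
    rw [real_inner_self_eq_norm_sq] at hv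
    rw [mem_ball_zero_iff]
    have h1 : ‖(v : 𝔼)‖ ^ 2 < (lam (chartAt 𝔼 b b))⁻¹ := by
      rwa [← one_div, lt_div_iff₀ hp, mul_comm]
    nlinarith [norm_nonneg (v : 𝔼)]
  contMDiff := by
    intro x₀
    rw [contMDiffAt_hom_bundle]
    refine ⟨contMDiffAt_id, ?_⟩
    -- In the trivialization at `x₀` the metric is `lam` in the fixed chart at `x₀` times the
    -- constant inner product, because the transition to the chart at `x` is an isometry. This
    -- expression is visibly smooth.
    have h1 : ContMDiffAt (𝓡 n) 𝓘(ℝ, 𝔼 →L[ℝ] 𝔼 →L[ℝ] ℝ) ∞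
        (fun x : M => lam (chartAt 𝔼 x₀ x) • (show 𝔼 →L[ℝ] 𝔼 →L[ℝ] ℝ from innerSL ℝ)) x₀ := by
      have h2 : ContMDiffAt (𝓡 n) 𝓘(ℝ) ∞ (fun x : M => lam (chartAt 𝔼 x₀ x)) x₀ := by
        have h3 : ContMDiffAt 𝓘(ℝ, 𝔼) 𝓘(ℝ) ∞ lam (chartAt 𝔼 x₀ x₀) :=
          ((h.contDiffOn x₀).contDiffAt ((chartAt 𝔼 x₀).open_target.mem_nhds
            (mem_chart_target _ x₀))).contMDiffAt
        exact h3.comp x₀ (contMDiffAt_extChartAt (I := 𝓡 n) (x := x₀))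
      exact h2.smul contMDiffAt_const
    refine h1.congr_of_eventuallyEq ?_
    filter_upwards [(chartAt 𝔼 x₀).open_source.mem_nhds (mem_chart_source _ x₀)] with x hx
    ext v w
    have key : ∀ φ : TangentSpace (𝓡 n) x →L[ℝ] TangentSpace (𝓡 n) x →L[ℝ] ℝ,
        ContinuousLinearMap.inCoordinates 𝔼 (TangentSpace (𝓡 n) (M := M)) (𝔼 →L[ℝ] ℝ)
          (fun b : M => TangentSpace (𝓡 n) b →L[ℝ] ℝ) x₀ x x₀ x φ v w =
        φ ((tangentBundleCore (𝓡 n) M).coordChange (achart 𝔼 x₀) (achart 𝔼 x) x v)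
          ((tangentBundleCore (𝓡 n) M).coordChange (achart 𝔼 x₀) (achart 𝔼 x) x w) := by
      intro φ
      have h4 := inCoordinates_apply_eq₂ (𝕜 := ℝ) (F₁ := 𝔼) (F₂ := 𝔼) (F₃ := ℝ)
        (E₁ := (TangentSpace (𝓡 n) (M := M))) (E₂ := (TangentSpace (𝓡 n) (M := M)))
        (E₃ := fun _ : M => ℝ) (x₀ := x₀) (x := x) (ϕ := φ) (v := v) (w := w)
        (by simpa using hx) (by simpa using hx) (by simp)
      have h7 : ∀ u : 𝔼, (trivializationAt 𝔼 (TangentSpace (𝓡 n)) x₀).symm x u =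
          (tangentBundleCore (𝓡 n) M).coordChange (achart 𝔼 x₀) (achart 𝔼 x) x u := fun u =>
        ((trivializationAt 𝔼 (TangentSpace (𝓡 n)) x₀).symmL_apply (R := ℝ) (by simpa using hx) u).symm.trans
          (congrArg (fun f : 𝔼 →L[ℝ] 𝔼 => f u)
            (TangentBundle.symmL_trivializationAt_eq_core (𝕜 := ℝ) (I := 𝓡 n) hx))
      refine h4.trans (Eq.trans ?_ (congrArg₂ (fun a b => φ a b) (h7 v) (h7 w)))
      simp
    refine (key _).trans ?_
    have h5 : (tangentBundleCore (𝓡 n) M).coordChange (achart 𝔼 x₀) (achart 𝔼 x) x =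
        fderiv ℝ (chartAt 𝔼 x ∘ (chartAt 𝔼 x₀).symm) (chartAt 𝔼 x₀ x) := by
      rw [← fderivWithin_extChartAt_comp, tangentBundleCore_coordChange_achart]
      rfl
    have h6 := h.inner_fderiv x₀ x (chartAt 𝔼 x₀ x) (by simp [hx]) v w
    rw [← h5, (chartAt 𝔼 x₀).left_inv hx] at h6
    exact h6

lemma IsConformalFactor.metric_inner (h : IsConformalFactor M lam) (b : M) (v w : 𝔼) :
    h.metric.inner b v w = lam (chartAt 𝔼 b b) * inner ℝ v w := by
  simp only [IsConformalFactor.metric]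
  rfl

/-- The preferred chart varies with the point, but transition maps preserve the conformal metric, so
every single chart sees the same formula on its whole target. -/
lemma IsConformalFactor.metricInChart_eq (h : IsConformalFactor M lam) (x : M) {y : 𝔼}
    (hy : y ∈ (chartAt 𝔼 x).target) :
    metricInChart h.metric x y = lam y • (1 : Matrix (Fin n) (Fin n) ℝ) := by
  ext i j
  have hs : (extChartAt (𝓡 n) x).symm y = (chartAt 𝔼 x).symm y := by simp [mfld_simps]
  have h1 := h.inner_fderiv x ((extChartAt (𝓡 n) x).symm y) y (by
    simp [mfld_simps, hy]) (EuclideanSpace.single i 1) (EuclideanSpace.single j 1)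
  rw [← hs, ← mfderiv_extChartAt_symm_eq x hy, ← mfderiv_extChartAt_symm_eq x hy] at h1
  refine Eq.trans ?_ (h1.trans ?_)
  · exact h.metric_inner _ _ _
  · rw [EuclideanSpace.inner_single_left]
    simp [Matrix.one_apply]

end ConformalMetric

/-! ### Quotients of open subsets of Euclidean space by free actions -/

section QuotientManifold

variable {E : Type*} {M : Type u} {n : ℕ} [TopologicalSpace E] [TopologicalSpace M]
  {Γ : Type*} [Group Γ] [MulAction Γ E] {p : E → M} {e : E → EuclideanSpace ℝ (Fin n)}

local notation "𝔼" => EuclideanSpace ℝ (Fin n)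

/-- The inverse of the chart `φ` is the composition of `p` with the inverse of `e`. -/
def IsSectionChart (p : E → M) (e : E → EuclideanSpace ℝ (Fin n))
    (φ : OpenPartialHomeomorph M (EuclideanSpace ℝ (Fin n))) : Prop :=
  ∀ y ∈ φ.target, ∃ z, e z = y ∧ φ.symm y = p z

/-- A local inverse of `p` followed by `e`. -/
lemma exists_isSectionChart [Nonempty E] (hp : IsLocalHomeomorph p) (hs : Function.Surjective p)
    (he : IsOpenEmbedding e) (x : M) : ∃ φ, x ∈ φ.source ∧ IsSectionChart p e φ := by
  obtain ⟨z, rfl⟩ := hs x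
  obtain ⟨ψ, hz, rfl⟩ := hp z
  refine ⟨ψ.symm ≫ₕ he.toOpenPartialHomeomorph e, by simp [hz], fun y hy => ?_⟩
  refine ⟨(he.toOpenPartialHomeomorph e).symm y, ?_, by simp⟩
  exact (he.toOpenPartialHomeomorph e).right_inv hy.1

/-- The two lifts of the point `φ.symm y` differ by some `γ`. For `z'` near `z`, both `z'` and `γ •
z'` still lie over the domains of the inverse charts and have the same image under `p`, so the same
`γ` describes the transition nearby. -/
lemma IsSectionChart.eventually_transition_eq (hp : IsQuotientCoveringMap p Γ)
    (he : IsOpenEmbedding e) {φ φ' : OpenPartialHomeomorph M 𝔼} (hφ : IsSectionChart p e φ)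
    (hφ' : IsSectionChart p e φ') {y : 𝔼} (hy : y ∈ (φ.symm ≫ₕ φ').source) :
    ∃ (γ : Γ) (z : E), e z = y ∧ ∀ᶠ z' in 𝓝 z, φ' (φ.symm (e z')) = e (γ • z') := by
  have hc := hp.continuous_const_smul
  obtain ⟨hy1, hy2⟩ : y ∈ φ.target ∧ φ.symm y ∈ φ'.source := by simpa using hy
  obtain ⟨z, rfl, hz⟩ := hφ y hy1
  obtain ⟨w, hw, hw'⟩ := hφ' _ (φ'.map_source hy2)
  rw [φ'.left_inv hy2, hz] at hw'
  obtain ⟨γ, rfl⟩ := hp.apply_eq_iff_mem_orbit.1 hw'.symm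
  have hw : e (γ • z) = _ := hw
  refine ⟨γ, z, rfl, ?_⟩
  have h1 : ∀ᶠ z' in 𝓝 z, e z' ∈ φ.target :=
    he.continuous.continuousAt.eventually (φ.open_target.mem_nhds hy1)
  have h2 : ∀ᶠ z' in 𝓝 z, e (γ • z') ∈ φ'.target := by
    refine (he.continuous.comp (hc γ)).continuousAt.eventually (φ'.open_target.mem_nhds ?_)
    change e (γ • z) ∈ _
    rw [hw]
    exact φ'.map_source hy2
  filter_upwards [h1, h2] with z' h1 h2
  obtain ⟨a, ha, ha'⟩ := hφ _ h1
  obtain ⟨b, hb, hb'⟩ := hφ' _ h2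
  rw [he.injective ha] at ha'
  rw [he.injective hb, hp.map_smul, ← ha'] at hb'
  rw [← hb', φ'.right_inv h2]

/-- The charted space structure on a quotient of an open subset of Euclidean space. -/
@[reducible]
noncomputable def quotientChartedSpace [Nonempty E] (hp : IsQuotientCoveringMap p Γ)
    (he : IsOpenEmbedding e) : ChartedSpace 𝔼 M where
  atlas := {φ | IsSectionChart p e φ}
  chartAt x := (exists_isSectionChart hp.isCoveringMap.isLocalHomeomorph hp.surjective he x).choose
  mem_chart_source x :=
    (exists_isSectionChart hp.isCoveringMap.isLocalHomeomorph hp.surjective he x).choose_spec.1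
  chart_mem_atlas x :=
    (exists_isSectionChart hp.isCoveringMap.isLocalHomeomorph hp.surjective he x).choose_spec.2

/-- The values of `f γ` off the image of `e` are irrelevant: `e` is open, so the action determines
the germ at each point of the image. -/
lemma IsSectionChart.transition_eventuallyEq (hp : IsQuotientCoveringMap p Γ)
    (he : IsOpenEmbedding e) {f : Γ → 𝔼 → 𝔼} (hf : ∀ γ z, f γ (e z) = e (γ • z))
    {φ φ' : OpenPartialHomeomorph M 𝔼} (hφ : IsSectionChart p e φ)
    (hφ' : IsSectionChart p e φ') {y : 𝔼} (hy : y ∈ (φ.symm ≫ₕ φ').source) :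
    ∃ (γ : Γ) (z : E), e z = y ∧ φ' ∘ φ.symm =ᶠ[𝓝 y] f γ := by
  obtain ⟨γ, z, rfl, h⟩ := hφ.eventually_transition_eq hp he hφ' hy
  refine ⟨γ, z, rfl, ?_⟩
  rw [← he.map_nhds_eq z, Filter.EventuallyEq, Filter.eventually_map]
  filter_upwards [h] with z' h
  rw [Function.comp_apply, h, hf]

lemma isManifold_quotientChartedSpace [Nonempty E] (hp : IsQuotientCoveringMap p Γ)
    (he : IsOpenEmbedding e) {f : Γ → 𝔼 → 𝔼} (hf : ∀ γ z, f γ (e z) = e (γ • z))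
    (hd : ∀ γ z, ContDiffAt ℝ ∞ (f γ) (e z)) :
    letI := quotientChartedSpace hp he
    IsManifold (𝓡 n) ∞ M := by
  let := quotientChartedSpace hp he
  refine isManifold_of_contDiffOn _ _ _ fun φ φ' hφ hφ' y hy => ?_
  obtain ⟨γ, z, rfl, h⟩ := IsSectionChart.transition_eventuallyEq hp he hf hφ hφ' hy.1
  exact ((hd γ z).congr_of_eventuallyEq h).contDiffWithinAt

lemma isConformalFactor_quotientChartedSpace [Nonempty E] (hp : IsQuotientCoveringMap p Γ)
    (he : IsOpenEmbedding e) {f : Γ → 𝔼 → 𝔼} (hf : ∀ γ z, f γ (e z) = e (γ • z))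
    {lam : 𝔼 → ℝ} (hpos : ∀ z, 0 < lam (e z)) (hlam : ∀ z, ContDiffAt ℝ ∞ lam (e z))
    (hinner : ∀ γ z (v w : 𝔼), lam (e (γ • z)) *
      inner ℝ (fderiv ℝ (f γ) (e z) v) (fderiv ℝ (f γ) (e z) w) = lam (e z) * inner ℝ v w) :
    letI := quotientChartedSpace hp he
    IsConformalFactor M lam := by
  let := quotientChartedSpace hp he
  have hmem : ∀ x : M, IsSectionChart p e (chartAt 𝔼 x) := fun x => chart_mem_atlas 𝔼 x
  refine ⟨fun x y hy => ?_, fun x y hy => ?_, fun x x' y hy v w => ?_⟩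
  · obtain ⟨z, rfl, -⟩ := hmem x y hy
    exact hpos z
  · obtain ⟨z, rfl, -⟩ := hmem x y hy
    exact (hlam z).contDiffWithinAt
  · obtain ⟨γ, z, rfl, h⟩ := IsSectionChart.transition_eventuallyEq hp he hf (hmem x) (hmem x') hy
    have h1 := h.eq_of_nhds
    rw [Function.comp_apply, hf] at h1
    rw [h.fderiv_eq, h1, hinner]

end QuotientManifold

/-! ### Curvature of the hyperbolic metric -/

section Curvature

variable {n : ℕ}

local notation "𝔼" => EuclideanSpace ℝ (Fin n)

/-- Derivatives depend only on germs. Hence so does the curvature, which is needed since the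
conformal formula for the metric holds only on chart targets. -/
lemma partialDeriv_congr {f f' : 𝔼 → ℝ} {y : 𝔼} (h : f =ᶠ[𝓝 y] f') (i : Fin n) :
    partialDeriv i f =ᶠ[𝓝 y] partialDeriv i f' := by
  filter_upwards [h.fderiv (𝕜 := ℝ)] with z hz
  rw [partialDeriv, partialDeriv, hz]

lemma christoffel_congr {g g' : 𝔼 → Matrix (Fin n) (Fin n) ℝ} {y : 𝔼} (h : g =ᶠ[𝓝 y] g')
    (k i j : Fin n) : christoffel g k i j =ᶠ[𝓝 y] christoffel g' k i j := by
  have h1 : ∀ a b : Fin n, (fun z => g z a b) =ᶠ[𝓝 y] fun z => g' z a b := fun a b => by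
    filter_upwards [h] with z hz
    rw [hz]
  have h2 : ∀ᶠ z in 𝓝 y, ∀ a b c, partialDeriv c (fun z => g z a b) z =
      partialDeriv c (fun z => g' z a b) z := by
    simp only [Filter.eventually_all]
    exact fun a b c => partialDeriv_congr (h1 a b) c
  filter_upwards [h, h2] with z hz h2
  simp only [christoffel, hz, h2]

lemma riemannTensor_congr {g g' : 𝔼 → Matrix (Fin n) (Fin n) ℝ} {y : 𝔼} (h : g =ᶠ[𝓝 y] g')
    (l i j k : Fin n) : riemannTensor g l i j k y = riemannTensor g' l i j k y := by
  simp only [riemannTensor, (partialDeriv_congr (christoffel_congr h _ _ _) _).eq_of_nhds,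
    (christoffel_congr h _ _ _).eq_of_nhds]

lemma curvatureForm_congr {g g' : 𝔼 → Matrix (Fin n) (Fin n) ℝ} {y : 𝔼} (h : g =ᶠ[𝓝 y] g')
    (v w : Fin n → ℝ) : curvatureForm g y v w = curvatureForm g' y v w := by
  simp only [curvatureForm, riemannTensor_congr h, h.eq_of_nhds]

end Curvature

/-! ### The upper half plane metric has constant curvature `-1`. -/

section Hyperbolic

local notation "𝔼₂" => EuclideanSpace ℝ (Fin 2)

/-- The conformal factor of the hyperbolic metric on the upper half plane. -/
noncomputable def hyperbolicFactor (y : EuclideanSpace ℝ (Fin 2)) : ℝ := ((y 1) ^ 2)⁻¹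

lemma partialDeriv_comp_coord {F : ℝ → ℝ} {F' : ℝ} {y : 𝔼₂} (h : HasDerivAt F F' (y 1))
    (i : Fin 2) : partialDeriv i (fun z => F (z 1)) y = if i = 1 then F' else 0 := by
  have h1 : HasFDerivAt (fun z : 𝔼₂ => F (z 1))
      (F' • (EuclideanSpace.proj 1 : 𝔼₂ →L[ℝ] ℝ)) y :=
    h.comp_hasFDerivAt y (EuclideanSpace.proj 1 : 𝔼₂ →L[ℝ] ℝ).hasFDerivAt
  rw [partialDeriv, h1.fderiv]
  fin_cases i <;> simp

/-- For a metric `λδ` one has `Γᵏᵢⱼ = (2λ)⁻¹ (∂ᵢλ δⱼₖ + ∂ⱼλ δᵢₖ - ∂ₖλ δᵢⱼ)`. Here `λ = y₁⁻²` depends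
on `y₁` alone, and `(2λ)⁻¹ ∂₁λ = -y₁⁻¹`. -/
lemma christoffel_hyperbolic {y : 𝔼₂} (hy : y 1 ≠ 0) (k i j : Fin 2) :
    christoffel (fun z => hyperbolicFactor z • (1 : Matrix (Fin 2) (Fin 2) ℝ)) k i j y =
      -(y 1)⁻¹ * ((if i = 1 ∧ j = k then 1 else 0) + (if j = 1 ∧ i = k then 1 else 0) -
        (if k = 1 ∧ i = j then 1 else 0)) := by
  have h1 : ∀ a b c : Fin 2, partialDeriv c
      (fun z : 𝔼₂ => (hyperbolicFactor z • (1 : Matrix (Fin 2) (Fin 2) ℝ)) a b) y =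
      if c = 1 ∧ a = b then -2 * ((y 1) ^ 3)⁻¹ else 0 := by
    intro a b c
    have h2 : HasDerivAt (fun t : ℝ => (t ^ 2)⁻¹ * (1 : Matrix (Fin 2) (Fin 2) ℝ) a b)
        ((-2 * ((y 1) ^ 3)⁻¹) * (1 : Matrix (Fin 2) (Fin 2) ℝ) a b) (y 1) := by
      refine HasDerivAt.mul_const (((hasDerivAt_pow 2 (y 1)).inv (pow_ne_zero 2 hy)).congr_deriv ?_) _
      field_simp
      norm_num [mul_comm]
    refine (partialDeriv_comp_coord h2 c).trans ?_
    by_cases hc : c = 1 <;> by_cases hab : a = b <;> simp [hc, hab, Matrix.one_apply]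
  have h3 : (hyperbolicFactor y • (1 : Matrix (Fin 2) (Fin 2) ℝ))⁻¹ =
      (y 1) ^ 2 • (1 : Matrix (Fin 2) (Fin 2) ℝ) := by
    refine Matrix.inv_eq_left_inv ?_
    rw [hyperbolicFactor, smul_mul_smul, mul_inv_cancel₀ (pow_ne_zero 2 hy), one_smul, one_mul]
  simp only [christoffel, h1, h3, Fin.sum_univ_two]
  fin_cases k <;> fin_cases i <;> fin_cases j <;> simp <;> field_simp

/-- The right side is minus the Gram determinant of `v` and `w` in the hyperbolic metric, that is,
curvature `-1`. -/
lemma curvatureForm_hyperbolic {y : 𝔼₂} (hy : y 1 ≠ 0) (v w : Fin 2 → ℝ) :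
    curvatureForm (fun z => hyperbolicFactor z • (1 : Matrix (Fin 2) (Fin 2) ℝ)) y v w =
      -((v 0 * w 1 - v 1 * w 0) ^ 2 * ((y 1) ^ 4)⁻¹) := by
  have h0 : ∀ᶠ z : 𝔼₂ in 𝓝 y, z 1 ≠ 0 :=
    (EuclideanSpace.proj 1 : 𝔼₂ →L[ℝ] ℝ).continuous.continuousAt.eventually_ne hy
  have h1 : ∀ a k i j : Fin 2, partialDeriv a
      (christoffel (fun z => hyperbolicFactor z • (1 : Matrix (Fin 2) (Fin 2) ℝ)) k i j) y =
      if a = 1 then ((y 1) ^ 2)⁻¹ * ((if i = 1 ∧ j = k then 1 else 0) +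
        (if j = 1 ∧ i = k then 1 else 0) - (if k = 1 ∧ i = j then 1 else 0)) else 0 := by
    intro a k i j
    refine (partialDeriv_congr (h0.mono fun z hz => christoffel_hyperbolic hz k i j)
      a).eq_of_nhds.trans ?_
    refine partialDeriv_comp_coord (F := fun t => -t⁻¹ * _) (HasDerivAt.mul_const ?_ _) a
    refine (hasDerivAt_inv hy).neg.congr_deriv ?_
    simp
  simp only [curvatureForm, riemannTensor, h1, christoffel_hyperbolic hy, Fin.sum_univ_two]
  simp [hyperbolicFactor]
  field_simp
  ring

lemma curvatureForm_nonpos_of_eventuallyEq {g : 𝔼₂ → Matrix (Fin 2) (Fin 2) ℝ} {y : 𝔼₂}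
    (hy : y 1 ≠ 0) (h : g =ᶠ[𝓝 y] fun z => hyperbolicFactor z • 1) (v w : Fin 2 → ℝ) :
    curvatureForm g y v w ≤ 0 := by
  rw [curvatureForm_congr h, curvatureForm_hyperbolic hy]
  have : 0 ≤ (v 0 * w 1 - v 1 * w 0) ^ 2 * ((y 1) ^ 4)⁻¹ := by positivity
  linarith

end Hyperbolic

/-! ### Compact quotients of the upper half plane -/

/-- Free groups are projective, and a lift of an injective map is injective. Thus a surjection from
a fundamental group onto a deck group is enough to find free subgroups. -/
lemma FreeGroup.exists_injective_of_surjective {α G H : Type*} [Group G] [Group H] {q : G →* H}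
    (hq : Function.Surjective q) {f : FreeGroup α →* H} (hf : Function.Injective f) :
    ∃ φ : FreeGroup α →* G, Function.Injective φ := by
  refine ⟨FreeGroup.lift fun a => Function.surjInv hq (f (FreeGroup.of a)), ?_⟩
  have h : q.comp (FreeGroup.lift fun a => Function.surjInv hq (f (FreeGroup.of a))) = f := by
    ext a
    simp [Function.surjInv_eq hq]
  refine Function.Injective.of_comp (f := q) ?_
  rw [← MonoidHom.coe_comp, h]
  exact hf

section UpperHalfPlaneQuotient

open UpperHalfPlane MatrixGroups

local notation "𝔼₂" => EuclideanSpace ℝ (Fin 2)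

lemma IsConformalFactor.isNonpositivelyCurved {M : Type u} [TopologicalSpace M]
    [ChartedSpace 𝔼₂ M] [IsManifold (𝓡 2) ∞ M] (h : IsConformalFactor M hyperbolicFactor)
    (h0 : ∀ x : M, chartAt 𝔼₂ x x 1 ≠ 0) : IsNonpositivelyCurved h.metric := by
  intro x v w
  rw [extChartAt_coe, modelWithCornersSelf_coe, Function.id_comp]
  refine curvatureForm_nonpos_of_eventuallyEq (h0 x) ?_ v w
  filter_upwards [(chartAt 𝔼₂ x).open_target.mem_nhds (mem_chart_target _ x)] with y hy
  exact h.metricInChart_eq x hy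

/-- The inclusion of the upper half plane in the Euclidean plane. -/
noncomputable def upperHalfPlaneToPlane (z : ℍ) : EuclideanSpace ℝ (Fin 2) :=
  Complex.orthonormalBasisOneI.repr (z : ℂ)

lemma isOpenEmbedding_upperHalfPlaneToPlane : IsOpenEmbedding upperHalfPlaneToPlane :=
  (Complex.orthonormalBasisOneI.repr.toHomeomorph.isOpenEmbedding).comp isOpenEmbedding_coe

lemma upperHalfPlaneToPlane_one (z : ℍ) : upperHalfPlaneToPlane z 1 = z.im := by
  simp [upperHalfPlaneToPlane]

/-- The extension of the Möbius transformation of `g` to the Euclidean plane. -/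
noncomputable def planeMoebius (g : SL(2, ℝ)) (y : EuclideanSpace ℝ (Fin 2)) :
    EuclideanSpace ℝ (Fin 2) :=
  upperHalfPlaneToPlane (g • ofComplex (Complex.orthonormalBasisOneI.repr.symm y))

lemma planeMoebius_apply (g : SL(2, ℝ)) (z : ℍ) :
    planeMoebius g (upperHalfPlaneToPlane z) = upperHalfPlaneToPlane (g • z) := by
  simp [planeMoebius, upperHalfPlaneToPlane]

lemma planeMoebius_eq_comp (g : SL(2, ℝ)) : planeMoebius g =
    Complex.orthonormalBasisOneI.repr ∘ (fun z => ↑((g : GL (Fin 2) ℝ) • ofComplex z) : ℂ → ℂ) ∘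
      Complex.orthonormalBasisOneI.repr.symm := rfl

lemma contDiffAt_planeMoebius (g : SL(2, ℝ)) (z : ℍ) :
    ContDiffAt ℝ ∞ (planeMoebius g) (upperHalfPlaneToPlane z) := by
  rw [planeMoebius_eq_comp]
  refine Complex.orthonormalBasisOneI.repr.contDiff.contDiffAt.comp _ (ContDiffAt.comp _ ?_
    Complex.orthonormalBasisOneI.repr.symm.contDiff.contDiffAt)
  rw [upperHalfPlaneToPlane, LinearIsometryEquiv.symm_apply_apply]
  exact ((analyticAt_smul (g := (g : GL (Fin 2) ℝ)) (by simp) z).contDiffAt).restrict_scalars ℝ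

/-- A Möbius transformation of determinant one has complex derivative `(cz + d)⁻²`. -/
lemma fderiv_planeMoebius (g : SL(2, ℝ)) (z : ℍ) (v : 𝔼₂) :
    fderiv ℝ (planeMoebius g) (upperHalfPlaneToPlane z) v =
      Complex.orthonormalBasisOneI.repr (Complex.orthonormalBasisOneI.repr.symm v *
        (1 / denom (g : GL (Fin 2) ℝ) z ^ 2)) := by
  have h1 : HasDerivAt (fun z => ↑((g : GL (Fin 2) ℝ) • ofComplex z) : ℂ → ℂ)
      (1 / denom (g : GL (Fin 2) ℝ) z ^ 2) z := by
    simpa using (hasStrictDerivAt_smul (g := (g : GL (Fin 2) ℝ)) (by simp) z).hasDerivAt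
  have h2 := h1.hasFDerivAt.restrictScalars ℝ
  have h3 := (Complex.orthonormalBasisOneI.repr.toContinuousLinearEquiv.hasFDerivAt
    (x := ((g • ofComplex (z : ℂ) : ℍ) : ℂ))).comp (z : ℂ) h2
  rw [← Complex.orthonormalBasisOneI.repr.symm_apply_apply (z : ℂ)] at h3
  have h4 := h3.comp (upperHalfPlaneToPlane z)
    (Complex.orthonormalBasisOneI.repr.symm.toContinuousLinearEquiv.hasFDerivAt)
  have h5 : HasFDerivAt (planeMoebius g) _ (upperHalfPlaneToPlane z) := h4
  rw [h5.fderiv]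
  simp

/-- The imaginary part scales by `|cz + d|⁻²` and so do lengths of tangent vectors; the two effects
cancel in the hyperbolic metric. -/
lemma hyperbolicFactor_planeMoebius (g : SL(2, ℝ)) (z : ℍ) (v w : 𝔼₂) :
    hyperbolicFactor (upperHalfPlaneToPlane (g • z)) *
      inner ℝ (fderiv ℝ (planeMoebius g) (upperHalfPlaneToPlane z) v)
        (fderiv ℝ (planeMoebius g) (upperHalfPlaneToPlane z) w) =
      hyperbolicFactor (upperHalfPlaneToPlane z) * inner ℝ v w := by
  have h1 : ∀ a b c : ℂ, inner ℝ (a * c) (b * c) = Complex.normSq c * inner ℝ a b := by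
    intro a b c
    simp [Complex.inner, Complex.normSq_apply]
    ring
  have h2 : (g • z).im = z.im / Complex.normSq (denom (g : GL (Fin 2) ℝ) z) := by
    refine (im_smul_eq_div_normSq (g : GL (Fin 2) ℝ) z).trans ?_
    simp
  have h3 : Complex.normSq (denom (g : GL (Fin 2) ℝ) z) ≠ 0 :=
    (normSq_denom_pos _ z.im_ne_zero).ne'
  have h4 := z.im_ne_zero
  rw [fderiv_planeMoebius, fderiv_planeMoebius, LinearIsometryEquiv.inner_map_map, h1,
    LinearIsometryEquiv.inner_map_map, hyperbolicFactor, hyperbolicFactor,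
    upperHalfPlaneToPlane_one, upperHalfPlaneToPlane_one, h2]
  simp only [map_div₀, map_one, map_pow]
  field_simp

/-- A discrete group acting freely and cocompactly has a closed hyperbolic surface as quotient, and
the fundamental group of this surface maps onto the group up to passing to the opposite. Free
subgroups of `Γ` therefore lift to the fundamental group. -/
theorem FICwFForNonpositivelyCurved.freeGroup {R : Type v} [Ring R]
    {ℋ : EquivariantHomologyTheory.{u, v, w} R} {𝓕 : GroupClass.{u}}
    (h2 : FICwFForNonpositivelyCurved ℋ 𝓕) (Γ : Subgroup SL(2, ℝ)) [DiscreteTopology Γ]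
    [IsCancelSMul Γ ℍ] {K : Set ℍ} (hK : IsCompact K) (hΓ : ∀ z : ℍ, ∃ γ ∈ Γ, γ • z ∈ K)
    {α : Type u} {f : FreeGroup α →* Γ} (hf : Function.Injective f) :
    SatisfiesFICwF ℋ 𝓕 (FreeGroup α) := by
  let M : Type u := ULift.{u} (Quotient (MulAction.orbitRel Γ ℍ))
  let p : ℍ → M := Homeomorph.ulift.symm ∘ Quotient.mk (MulAction.orbitRel Γ ℍ)
  have hp : IsQuotientCoveringMap p Γ :=
    isQuotientCoveringMap_quotientMk_of_properlyDiscontinuousSMul.homeomorph_comp _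
  have he := isOpenEmbedding_upperHalfPlaneToPlane
  have hfe : ∀ (γ : Γ) z, planeMoebius γ (upperHalfPlaneToPlane z) =
    upperHalfPlaneToPlane (γ • z) := fun γ z => planeMoebius_apply γ z
  have hpos : ∀ z : ℍ, upperHalfPlaneToPlane z 1 ≠ 0 := fun z => by
    rw [upperHalfPlaneToPlane_one]
    exact z.im_ne_zero
  let : ChartedSpace 𝔼₂ M := quotientChartedSpace hp he
  have : IsManifold (𝓡 2) ∞ M :=
    isManifold_quotientChartedSpace hp he hfe fun γ z => contDiffAt_planeMoebius γ z
  have hlam : IsConformalFactor M hyperbolicFactor := by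
    refine isConformalFactor_quotientChartedSpace hp he hfe (fun z => ?_) (fun z => ?_)
      fun γ z v w => hyperbolicFactor_planeMoebius γ z v w
    · have := hpos z
      rw [hyperbolicFactor]
      positivity
    · exact ((EuclideanSpace.proj 1 : 𝔼₂ →L[ℝ] ℝ).contDiff.contDiffAt.pow 2).inv
        (pow_ne_zero 2 (hpos z))
  have hc : IsNonpositivelyCurved hlam.metric := by
    refine hlam.isNonpositivelyCurved fun x => ?_
    obtain ⟨z, hz, -⟩ := (chart_mem_atlas 𝔼₂ x : IsSectionChart p _ _) _ (mem_chart_target 𝔼₂ x)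
    rw [← hz]
    exact hpos z
  have : T2Space (Quotient (MulAction.orbitRel Γ ℍ)) :=
    t2Space_of_properlyDiscontinuousSMul_of_t2Space
  have : T2Space M := Homeomorph.ulift.symm.t2Space
  have : CompactSpace M := by
    refine ⟨(hK.image hp.continuous).of_isClosed_subset isClosed_univ fun x _ => ?_⟩
    obtain ⟨z, rfl⟩ := hp.surjective x
    obtain ⟨γ, hγ, h⟩ := hΓ z
    exact ⟨_, h, hp.map_smul (⟨γ, hγ⟩ : Γ)⟩
  have : ConnectedSpace M := hp.surjective.connectedSpace hp.continuous
  let x : M := p UpperHalfPlane.I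
  -- Monodromy is onto because `ℍ` is path connected; simple connectedness plays no role. Inversion
  -- identifies `Γ` with its opposite.
  have hq := hp.fundamentalGroupToMulOpposite_surjective (⟨UpperHalfPlane.I, rfl⟩ : p ⁻¹' {x})
  obtain ⟨φ, hφ⟩ := FreeGroup.exists_injective_of_surjective hq
    (f := (MulEquiv.inv' Γ).toMonoidHom.comp f) ((MulEquiv.inv' Γ).injective.comp hf)
  exact (h2 2 M hlam.metric hc x).of_injective φ hφ

end UpperHalfPlaneQuotient

/-! ### A torsion-free group of units of an indefinite quaternion order -/

section QuaternionGroup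

open UpperHalfPlane MatrixGroups

/-- The order `ℤ⟨1, i, j, ij⟩` of the quaternion algebra with `i² = -1` and `j² = 3`. -/
abbrev QuaternionOrder : Type := QuaternionAlgebra ℤ (-1) 0 3

/-- The reduced norm. -/
def QuaternionOrder.norm (q : QuaternionOrder) : ℤ :=
  q.re ^ 2 + q.imI ^ 2 - 3 * (q.imJ ^ 2 + q.imK ^ 2)

/-- The embedding of the quaternion order in the real matrices. -/
noncomputable def QuaternionOrder.toMatrix : QuaternionOrder →+* Matrix (Fin 2) (Fin 2) ℝ where
  toFun q := !![q.re + q.imJ * √3, q.imI - q.imK * √3; -q.imI - q.imK * √3, q.re - q.imJ * √3]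
  map_one' := by
    ext i j
    fin_cases i <;> fin_cases j <;> simp
  map_zero' := by
    ext i j
    fin_cases i <;> fin_cases j <;> simp
  map_add' p q := by
    ext i j
    fin_cases i <;> fin_cases j <;> simp <;> ring
  map_mul' p q := by
    have h : √3 * √3 = (3 : ℝ) := Real.mul_self_sqrt (by norm_num)
    ext i j
    fin_cases i <;> fin_cases j <;> simp [Matrix.mul_apply, Fin.sum_univ_two]
    · linear_combination (-(p.imJ * q.imJ : ℝ) - p.imK * q.imK) * h
    · linear_combination ((p.imJ * q.imK : ℝ) - p.imK * q.imJ) * h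
    · linear_combination (-(p.imJ * q.imK : ℝ) + p.imK * q.imJ) * h
    · linear_combination (-(p.imJ * q.imJ : ℝ) - p.imK * q.imK) * h

namespace QuaternionOrder

lemma toMatrix_apply (q : QuaternionOrder) : toMatrix q =
    !![q.re + q.imJ * √3, q.imI - q.imK * √3; -q.imI - q.imK * √3, q.re - q.imJ * √3] := rfl

lemma toMatrix_trace (q : QuaternionOrder) : toMatrix q 0 0 + toMatrix q 1 1 = 2 * q.re := by
  simp [toMatrix_apply]
  ring

lemma det_toMatrix (q : QuaternionOrder) : (toMatrix q).det = q.norm := by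
  have h : √3 * √3 = (3 : ℝ) := Real.mul_self_sqrt (by norm_num)
  rw [toMatrix_apply, Matrix.det_fin_two_of, norm]
  push_cast
  linear_combination (-(q.imJ : ℝ) ^ 2 - q.imK ^ 2) * h

lemma adjugate_toMatrix (q : QuaternionOrder) : (toMatrix q).adjugate = toMatrix (star q) := by
  rw [toMatrix_apply, Matrix.adjugate_fin_two_of, toMatrix_apply]
  ext i j
  fin_cases i <;> fin_cases j <;> simp <;> ring

lemma star_mul_self (q : QuaternionOrder) : star q * q = (q.norm : QuaternionOrder) := by
  ext
  · simp
    rw [norm]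
    ring
  all_goals
    simp
    try ring

lemma norm_mul (p q : QuaternionOrder) : (p * q).norm = p.norm * q.norm := by
  have h : ((p * q).norm : ℝ) = (p.norm * q.norm : ℤ) := by
    rw [← det_toMatrix, map_mul, Matrix.det_mul, det_toMatrix, det_toMatrix]
    push_cast
    rfl
  exact_mod_cast h

lemma norm_star (q : QuaternionOrder) : (star q).norm = q.norm := by
  simp [norm]

/-- The norm form is anisotropic. -/
lemma eq_zero_of_norm_eq_zero {q : QuaternionOrder} (h : q.norm = 0) : q = 0 := by
  have h3 : Fact (Nat.Prime 3) := ⟨Nat.prime_three⟩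
  -- A nonzero sum of two squares has even `3`-adic valuation, since `3 ≡ 3` modulo `4`. Both sums
  -- cannot satisfy this when they differ by a factor `3`.
  have key : ∀ a b c d : ℕ, a ^ 2 + b ^ 2 = 3 * (c ^ 2 + d ^ 2) → c ^ 2 + d ^ 2 = 0 := by
    intro a b c d h
    by_contra hn
    have hsq : ∀ n : ℕ, n ≠ 0 → (∃ x y, n = x ^ 2 + y ^ 2) → Even (padicValNat 3 n) := by
      intro n hn hxy
      by_cases hd : 3 ∣ n
      · exact Nat.eq_sq_add_sq_iff.1 hxy 3 (Nat.mem_primeFactors.2 ⟨Nat.prime_three, hd, hn⟩) rfl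
      · rw [padicValNat.eq_zero_of_not_dvd hd]
        exact Even.zero
    have h1 := hsq _ hn ⟨c, d, rfl⟩
    have h2 := hsq _ (mul_ne_zero three_ne_zero hn) ⟨a, b, h.symm⟩
    rw [padicValNat.mul three_ne_zero hn, padicValNat_self] at h2
    rw [Nat.even_add, iff_true_right h1] at h2
    exact absurd h2 (by decide)
  have h1 := key q.re.natAbs q.imI.natAbs q.imJ.natAbs q.imK.natAbs (by
    zify
    simp only [sq_abs]
    rw [norm] at h
    linarith)
  have h2 : q.imJ ^ 2 + q.imK ^ 2 = 0 := by
    zify at h1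
    simpa only [sq_abs] using h1
  rw [norm, h2] at h
  have h4 : q.imJ = 0 := by nlinarith [sq_nonneg q.imJ, sq_nonneg q.imK]
  have h5 : q.imK = 0 := by nlinarith [sq_nonneg q.imJ, sq_nonneg q.imK]
  have h6 : q.re = 0 := by nlinarith [sq_nonneg q.re, sq_nonneg q.imI]
  have h7 : q.imI = 0 := by nlinarith [sq_nonneg q.re, sq_nonneg q.imI]
  ext <;> simpa

end QuaternionOrder

open QuaternionOrder

/-- The elements of norm one of the quaternion order that are congruent to `1` modulo `3`. -/
noncomputable def quaternionGroup : Subgroup SL(2, ℝ) where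
  carrier := {g | ∃ q : QuaternionOrder, (g : Matrix (Fin 2) (Fin 2) ℝ) = toMatrix (1 + (3 : ℤ) • q)}
  one_mem' := ⟨0, by simp⟩
  mul_mem' := by
    rintro g h ⟨p, hp⟩ ⟨q, hq⟩
    refine ⟨p + q + (3 : ℤ) • (p * q), ?_⟩
    rw [Matrix.SpecialLinearGroup.coe_mul, hp, hq, ← map_mul]
    congr 1
    noncomm_ring
  inv_mem' := by
    rintro g ⟨p, hp⟩
    refine ⟨star p, ?_⟩
    rw [Matrix.SpecialLinearGroup.coe_inv, hp, adjugate_toMatrix, star_add, star_one, star_smul, star_trivial]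

/-- The four quantities are `q.re - 1`, `2 q.imI`, `2√3 q.imJ` and `-2√3 q.imK`, so the bounds force
integers of absolute value less than one. They define a neighbourhood isolating `1`. -/
lemma toMatrix_eq_one {q : QuaternionOrder} (h1 : |(toMatrix q 0 0 + toMatrix q 1 1) / 2 - 1| < 1)
    (h2 : |(toMatrix q 0 1 - toMatrix q 1 0)| < 2) (h3 : |toMatrix q 0 0 - toMatrix q 1 1| < 2)
    (h4 : |toMatrix q 0 1 + toMatrix q 1 0| < 2) : q = 1 := by
  have h : 1 ≤ √3 := Real.one_le_sqrt.2 (by norm_num)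
  rw [toMatrix_apply] at h1 h2 h3 h4
  simp at h1 h2 h3 h4
  have e1 : q.re = 1 := by
    have := Int.abs_lt_one_iff.1 (by exact_mod_cast h1 : |q.re - 1| < 1)
    omega
  have e2 : q.imI = 0 := by
    rw [show (q.imI : ℝ) + q.imI = 2 * q.imI by ring, abs_mul,
      abs_two, ← Int.cast_abs] at h2
    exact Int.abs_lt_one_iff.1 (by exact_mod_cast (by linarith : ((|q.imI| : ℤ) : ℝ) < 1))
  have aux : ∀ a : ℤ, |2 * ((a : ℝ) * √3)| < 2 → a = 0 := by
    intro a ha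
    rw [abs_mul, abs_two, abs_mul, abs_of_nonneg (Real.sqrt_nonneg 3), ← Int.cast_abs] at ha
    refine Int.abs_lt_one_iff.1 ?_
    have h0 : (0 : ℝ) ≤ (|a| : ℤ) := by exact_mod_cast abs_nonneg a
    exact_mod_cast (by nlinarith : ((|a| : ℤ) : ℝ) < 1)
  have e3 : q.imJ = 0 := aux _ (by convert h3 using 2; ring)
  have e4 : q.imK = 0 := aux _ (by rw [← abs_neg]; convert h4 using 2; ring)
  ext <;> simp [e1, e2, e3, e4]

instance discreteTopology_quaternionGroup : DiscreteTopology quaternionGroup := by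
  refine discreteTopology_of_isOpen_singleton_one ?_
  have hc : ∀ i j, Continuous fun g : quaternionGroup => (g : SL(2, ℝ)) i j := fun i j =>
    ((continuous_apply_apply i j).comp Matrix.SpecialLinearGroup.isClosedEmbedding_val.continuous).comp
      continuous_subtype_val
  let U : Set quaternionGroup := {g | |((g : SL(2, ℝ)) 0 0 + (g : SL(2, ℝ)) 1 1) / 2 - 1| < 1} ∩
    {g | |(g : SL(2, ℝ)) 0 1 - (g : SL(2, ℝ)) 1 0| < 2} ∩
    {g | |(g : SL(2, ℝ)) 0 0 - (g : SL(2, ℝ)) 1 1| < 2} ∩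
    {g | |(g : SL(2, ℝ)) 0 1 + (g : SL(2, ℝ)) 1 0| < 2}
  have hU : IsOpen U := by
    refine ((IsOpen.inter ?_ ?_).inter ?_).inter ?_
    · exact isOpen_lt ((((hc 0 0).add (hc 1 1)).div_const 2).sub continuous_const).abs
        continuous_const
    · exact isOpen_lt ((hc 0 1).sub (hc 1 0)).abs continuous_const
    · exact isOpen_lt ((hc 0 0).sub (hc 1 1)).abs continuous_const
    · exact isOpen_lt ((hc 0 1).add (hc 1 0)).abs continuous_const
  convert hU
  ext g
  simp only [mem_singleton_iff]
  constructor
  · rintro rfl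
    simp [U]
  · rintro ⟨⟨⟨h1, h2⟩, h3⟩, h4⟩
    obtain ⟨q, hq⟩ := g.2
    simp only [mem_ofPred_eq, hq] at h1 h2 h3 h4
    apply Subtype.ext
    apply Subtype.ext
    rw [hq, toMatrix_eq_one h1 h2 h3 h4, map_one]
    rfl

/-- A fixed point in `ℍ` bounds half the trace by one in absolute value. Half the trace is an
integer congruent to `1` modulo `3`, so it must be `1`, and the only such element with a fixed point
is the identity. -/
lemma eq_one_of_smul_eq_of_mem_quaternionGroup {g : SL(2, ℝ)} (hg : g ∈ quaternionGroup) {z : ℍ}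
    (h : g • z = z) : g = 1 := by
  obtain ⟨q, hq⟩ := hg
  have hz := congrArg (fun z : ℍ => (z : ℂ)) h
  have hden : ((g 1 0 : ℝ) : ℂ) * z + (g 1 1 : ℝ) ≠ 0 :=
    denom_ne_zero (g : GL (Fin 2) ℝ) z
  simp only [coe_specialLinearGroup_apply] at hz
  rw [div_eq_iff (by simpa using hden)] at hz
  have hre := congrArg Complex.re hz
  have him := congrArg Complex.im hz
  simp at hre him
  have hy := z.im_pos
  have hd := g.2
  rw [Matrix.det_fin_two] at hd
  have htr : (g 0 0 : ℝ) + g 1 1 = 2 * (1 + 3 * q.re : ℤ) := by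
    rw [hq, toMatrix_trace, QuaternionAlgebra.re_add, QuaternionAlgebra.re_one,
      QuaternionAlgebra.re_smul, smul_eq_mul]
  have h1 : (g 0 0 : ℝ) = 2 * g 1 0 * z.re + g 1 1 := by
    refine mul_right_cancel₀ hy.ne' ?_
    linarith
  have h2 : (g 0 1 : ℝ) = - g 1 0 * (z.re ^ 2 + z.im ^ 2) := by
    rw [h1] at hre
    linarith
  -- The fixed point equation and determinant one give `(tr / 2)² = 1 - (c Im z)²`. The left side is
  -- the square of a nonzero integer, hence `c = 0`.
  have h3 : ((1 + 3 * q.re : ℤ) : ℝ) ^ 2 = 1 - (g 1 0 * z.im) ^ 2 := by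
    rw [h1, h2] at hd
    rw [h1] at htr
    have hn : ((1 + 3 * q.re : ℤ) : ℝ) = g 1 0 * z.re + g 1 1 := by linarith
    rw [hn]
    linear_combination hd
  have h4 : (1 : ℝ) ≤ ((1 + 3 * q.re : ℤ) : ℝ) ^ 2 := by
    have : 0 < (1 + 3 * q.re) ^ 2 := by
      refine sq_pos_of_ne_zero ?_
      omega
    exact_mod_cast this
  have h5 : g 1 0 = 0 := by
    have : g 1 0 * z.im = 0 := by nlinarith
    exact (mul_eq_zero.1 this).resolve_right hy.ne'
  rw [h5] at h1 h2 h3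
  have h6 : q.re = 0 := by
    have : (1 + 3 * q.re) ^ 2 = 1 := by
      have : ((1 + 3 * q.re : ℤ) : ℝ) ^ 2 = 1 := by linarith
      exact_mod_cast this
    rcases sq_eq_one_iff.1 this with h | h <;> omega
  apply Subtype.ext
  ext i j
  rw [h6] at htr
  simp at htr h1 h2
  fin_cases i <;> fin_cases j <;> simp [h5, h2] <;> linarith

instance isCancelSMul_quaternionGroup : IsCancelSMul quaternionGroup ℍ where
  left_cancel' g z w h := (smul_left_cancel_iff g).1 h
  right_cancel' g h z hgh := by
    have h1 : (h⁻¹ * g) • z = z := by rw [mul_smul, hgh, inv_smul_smul]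
    have h2 := eq_one_of_smul_eq_of_mem_quaternionGroup (h⁻¹ * g).2 h1
    exact (inv_mul_eq_one.1 (Subtype.ext h2 : h⁻¹ * g = 1)).symm

end QuaternionGroup

/-! ### Cocompactness -/

/-- Minkowski's theorem on linear forms. -/
lemma Matrix.exists_int_mulVec_lt {ι : Type*} [Fintype ι] [DecidableEq ι] (A : Matrix ι ι ℝ)
    (hA : A.det ≠ 0) {r : ℝ} (hr : 0 < r) (h : |A.det| < r ^ Fintype.card ι) :
    ∃ x : ι → ℤ, x ≠ 0 ∧ ∀ i, |A.mulVec (fun j => (x j : ℝ)) i| < r := by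
  classical
  let b := Pi.basisFun ℝ ι
  let L : AddSubgroup (ι → ℝ) := (Submodule.span ℤ (Set.range b)).toAddSubgroup
  have hL : Countable L := inferInstanceAs (Countable (Submodule.span ℤ (Set.range b)))
  let s : Set (ι → ℝ) := Matrix.toLin' A ⁻¹' univ.pi fun _ => Ioo (-r) r
  have hs : ∀ x, x ∈ s ↔ ∀ i, |A.mulVec x i| < r := by
    intro x
    simp [s, abs_lt]
  have h1 : ∀ x ∈ s, -x ∈ s := by
    intro x hx
    rw [hs] at hx ⊢
    simpa [Matrix.mulVec_neg] using hx
  have h2 : Convex ℝ s := (convex_pi fun _ _ => convex_Ioo _ _).linear_preimage _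
  -- The box pulled back by `A` has volume `(2r)ᵈ / |det A|` with `d` the number of coordinates, and
  -- `ℤᵈ` has covolume one.
  have h3 : MeasureTheory.volume (ZSpan.fundamentalDomain b) *
      2 ^ Module.finrank ℝ (ι → ℝ) < MeasureTheory.volume s := by
    rw [MeasureTheory.Measure.addHaar_preimage_linearMap _ (by rwa [LinearMap.det_toLin']),
      LinearMap.det_toLin', Real.volume_pi_Ioo, ZSpan.volume_fundamentalDomain]
    have hb : (Matrix.of b).det = 1 := by
      rw [show Matrix.of b = 1 by ext i j; simp [b, Matrix.one_apply, Pi.single_apply, eq_comm]]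
      exact Matrix.det_one
    rw [hb, abs_one, ENNReal.ofReal_one, one_mul, Module.finrank_fintype_fun_eq_card,
      Finset.prod_const, Finset.card_univ, ← ENNReal.ofReal_pow (by linarith),
      ← ENNReal.ofReal_mul (abs_nonneg _)]
    rw [show (2 : ENNReal) = ENNReal.ofReal 2 by simp, ← ENNReal.ofReal_pow (by norm_num),
      abs_inv]
    have hd := abs_pos.2 hA
    refine ENNReal.ofReal_lt_ofReal_iff_of_nonneg (by positivity) |>.2 ?_
    rw [show r - -r = 2 * r by ring, mul_pow, ← div_eq_inv_mul, lt_div_iff₀ hd]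
    gcongr
  obtain ⟨x, hx0, hx⟩ := MeasureTheory.exists_ne_zero_mem_lattice_of_measure_mul_two_pow_lt_measure
    (L := L) (ZSpan.isAddFundamentalDomain b MeasureTheory.volume) h1 h2 h3
  have hx' : ∀ i, ∃ m : ℤ, (m : ℝ) = (x : ι → ℝ) i := fun i => by
    have := (b.mem_span_iff_repr_mem ℤ (x : ι → ℝ)).1 x.2 i
    simpa [b] using this
  choose y hy using hx'
  have hy' : (fun j => (y j : ℝ)) = (x : ι → ℝ) := funext hy
  refine ⟨y, ?_, ?_⟩
  · rintro rfl
    refine hx0 (Subtype.ext ?_)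
    rw [← hy']
    ext
    simp
  · rw [hy']
    exact (hs _).1 hx

section QuaternionGroup

open UpperHalfPlane MatrixGroups QuaternionOrder

/-- The entries of the product are four linear forms in the coordinates of `q` with determinant
`-12`, and `12 < 2⁴`, so Minkowski's theorem applies with bound `2`. -/
lemma exists_quaternion_mul_lt (g : SL(2, ℝ)) : ∃ q : QuaternionOrder, q ≠ 0 ∧
    ∀ i j, |(toMatrix q * (g : Matrix (Fin 2) (Fin 2) ℝ)) i j| < 2 := by
  let A : Matrix (Fin 4) (Fin 4) ℝ :=
    !![g 0 0, g 1 0, √3 * g 0 0, -√3 * g 1 0;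
       g 0 1, g 1 1, √3 * g 0 1, -√3 * g 1 1;
       g 1 0, -g 0 0, -√3 * g 1 0, -√3 * g 0 0;
       g 1 1, -g 0 1, -√3 * g 1 1, -√3 * g 0 1]
  have h3 : √3 ^ 2 = (3 : ℝ) := Real.sq_sqrt (by norm_num)
  have hg := g.2
  rw [Matrix.det_fin_two] at hg
  have hA : A.det = -12 * (g 0 0 * g 1 1 - g 0 1 * g 1 0) ^ 2 := by
    simp [A, Matrix.det_succ_row_zero, Fin.sum_univ_succ, Fin.succAbove]
    linear_combination -4 * (g 0 0 * g 1 1 - g 0 1 * g 1 0) ^ 2 * h3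
  rw [hg] at hA
  obtain ⟨x, hx0, hx⟩ := A.exists_int_mulVec_lt (by rw [hA]; norm_num) (r := 2) (by norm_num)
    (by rw [hA]; norm_num)
  refine ⟨⟨x 0, x 1, x 2, x 3⟩, ?_, ?_⟩
  · intro h
    apply hx0
    have := congrArg QuaternionAlgebra.re h
    have := congrArg QuaternionAlgebra.imI h
    have := congrArg QuaternionAlgebra.imJ h
    have := congrArg QuaternionAlgebra.imK h
    ext i
    fin_cases i <;> simp_all
  · have e0 := hx 0
    have e1 := hx 1
    have e2 := hx 2
    have e3 := hx 3
    simp [A, Matrix.mulVec, dotProduct, Fin.sum_univ_succ] at e0 e1 e2 e3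
    intro i j
    fin_cases i <;> fin_cases j <;>
      simp [toMatrix_apply, Matrix.mul_apply, Fin.sum_univ_two]
    · convert e0 using 2; ring
    · convert e1 using 2; ring
    · convert e2 using 2; ring
    · convert e3 using 2; ring

lemma abs_norm_le {g : SL(2, ℝ)} {q : QuaternionOrder}
    (h : ∀ i j, |(toMatrix q * (g : Matrix (Fin 2) (Fin 2) ℝ)) i j| < 2) : |q.norm| ≤ 8 := by
  have h1 : ((q.norm : ℤ) : ℝ) = (toMatrix q * (g : Matrix (Fin 2) (Fin 2) ℝ)).det := by
    rw [Matrix.det_mul, g.2, det_toMatrix, mul_one]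
  rw [Matrix.det_fin_two] at h1
  have h2 : ∀ a b c d : ℝ, |a| < 2 → |b| < 2 → |c| < 2 → |d| < 2 → |a * b - c * d| ≤ 8 := by
    intro a b c d ha hb hc hd
    refine (abs_sub _ _).trans ?_
    rw [abs_mul, abs_mul]
    nlinarith [abs_nonneg a, abs_nonneg b, abs_nonneg c, abs_nonneg d]
  have h3 := h2 _ _ _ _ (h 0 0) (h 1 1) (h 0 1) (h 1 0)
  rw [← h1] at h3
  exact_mod_cast h3

/-- Two quaternions of the same norm that are congruent differ by an element of the group. -/
lemma exists_mem_quaternionGroup_mul {p q : QuaternionOrder} (hn : p.norm = q.norm)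
    (h0 : q.norm ≠ 0) {r : QuaternionOrder} (h : p = q + (3 * q.norm) • r) :
    ∃ γ ∈ quaternionGroup, toMatrix q * (γ : Matrix (Fin 2) (Fin 2) ℝ) = toMatrix p := by
  -- The quotient `q⁻¹p` equals `1 + 3 q̄ r`: the factor `q.norm` in the congruence clears the
  -- denominator of `q⁻¹`, and the factor `3` gives the congruence defining the group.
  have h1 : star q * p = q.norm • (1 + (3 : ℤ) • (star q * r)) := by
    rw [h, mul_add, star_mul_self, mul_smul_comm, smul_add, smul_smul, mul_comm q.norm 3]
    simp
  have h2 : (1 + (3 : ℤ) • (star q * r)).norm = 1 := by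
    have h3 := congrArg QuaternionOrder.norm h1
    rw [norm_mul, norm_star, hn] at h3
    have h4 : ∀ (m : ℤ) (a : QuaternionOrder), (m • a).norm = m ^ 2 * a.norm := by
      intro m a
      simp only [QuaternionOrder.norm, QuaternionAlgebra.re_smul, QuaternionAlgebra.imI_smul,
        QuaternionAlgebra.imJ_smul, QuaternionAlgebra.imK_smul, smul_eq_mul]
      ring
    rw [h4, ← sq] at h3
    exact (mul_right_eq_self₀.1 h3.symm).resolve_right (pow_ne_zero 2 h0)
  refine ⟨⟨toMatrix (1 + (3 : ℤ) • (star q * r)), by rw [det_toMatrix, h2]; simp⟩, ⟨_, rfl⟩, ?_⟩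
  have h5 : q.norm • (q * (1 + (3 : ℤ) • (star q * r))) = q.norm • p := by
    rw [← mul_smul_comm, ← h1, ← mul_assoc]
    have : q * star q = (q.norm : QuaternionOrder) := by
      have := star_mul_self (star q)
      rwa [star_star, norm_star] at this
    rw [this]
    simp
  have h6 : q * (1 + (3 : ℤ) • (star q * r)) = p := by
    have h7 : ∀ a b : ℤ, q.norm * a = q.norm * b → a = b := fun a b => mul_left_cancel₀ h0
    ext
    · exact h7 _ _ (congrArg QuaternionAlgebra.re h5)
    · exact h7 _ _ (congrArg QuaternionAlgebra.imI h5)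
    · exact h7 _ _ (congrArg QuaternionAlgebra.imJ h5)
    · exact h7 _ _ (congrArg QuaternionAlgebra.imK h5)
  change toMatrix q * toMatrix _ = _
  rw [← map_mul, h6]

/-- The quaternion group acts cocompactly on the upper half plane. -/
theorem exists_isCompact_quaternionGroup_smul_mem :
    ∃ K : Set ℍ, IsCompact K ∧ ∀ z : ℍ, ∃ γ ∈ quaternionGroup, γ • z ∈ K := by
  classical
  let X : Type := {q : QuaternionOrder // q.norm ≠ 0 ∧ |q.norm| ≤ 8}
  -- This modulus is divisible by `3n` for every nonzero `n` with `|n| ≤ 8`.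
  let N : ℕ := 3 * Nat.factorial 8
  let T : Type := Finset.Icc (-8 : ℤ) 8 × ZMod N × ZMod N × ZMod N × ZMod N
  have hN : NeZero N := ⟨by decide⟩
  -- Elements with the same value of `c` have the same norm and are congruent modulo three times
  -- that norm, so they differ by the group on the right. There are finitely many values.
  let c : X → T := fun q => (⟨q.1.norm, Finset.mem_Icc.2 (abs_le.1 q.2.2)⟩,
    q.1.re, q.1.imI, q.1.imJ, q.1.imK)
  let B (q : QuaternionOrder) : Set SL(2, ℝ) :=
    {h | ∀ i j, |(toMatrix q * (h : Matrix (Fin 2) (Fin 2) ℝ)) i j| ≤ 2}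
  have hB : ∀ q : QuaternionOrder, q.norm ≠ 0 → IsCompact (B q) := by
    intro q hq
    have hdet : IsUnit (toMatrix q).det := by
      rw [det_toMatrix, isUnit_iff_ne_zero]
      exact_mod_cast hq
    have h1 : IsCompact {A : Matrix (Fin 2) (Fin 2) ℝ | ∀ i j, |A i j| ≤ 2} := by
      have : {A : Matrix (Fin 2) (Fin 2) ℝ | ∀ i j, |A i j| ≤ 2} =
          univ.pi fun _ => univ.pi fun _ => Icc (-2) 2 := by
        ext A
        simp only [mem_ofPred_eq, abs_le]
        exact ⟨fun h i _ j _ => h i j, fun h i j => h i trivial j trivial⟩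
      rw [this]
      exact isCompact_univ_pi fun _ => isCompact_univ_pi fun _ => isCompact_Icc
    have h2 := h1.image (f := fun A => (toMatrix q)⁻¹ * A) (continuous_const.matrix_mul continuous_id)
    refine (Matrix.SpecialLinearGroup.isClosedEmbedding_val.isCompact_preimage h2).of_isClosed_subset
      ?_ fun h hh => ?_
    · have hc : ∀ i j, Continuous fun h : SL(2, ℝ) =>
          (toMatrix q * (h : Matrix (Fin 2) (Fin 2) ℝ)) i j := fun i j =>
        (continuous_apply_apply i j).comp (continuous_const.matrix_mul
          Matrix.SpecialLinearGroup.isClosedEmbedding_val.continuous)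
      simp only [B, ofPred_forall]
      exact isClosed_iInter fun i => isClosed_iInter fun j =>
        isClosed_le (hc i j).abs continuous_const
    · refine ⟨toMatrix q * h.1, hh, ?_⟩
      simp [← mul_assoc, Matrix.nonsing_inv_mul _ hdet]
  -- One representative `q` per class; `B q` is compact because left multiplication by the
  -- invertible matrix of `q` carries it into a bounded box.
  refine ⟨⋃ t : range c, (fun h : SL(2, ℝ) => h • UpperHalfPlane.I) ''
    B (rangeSplitting c t).1, ?_, fun z => ?_⟩
  · refine isCompact_iUnion fun t => (hB _ (rangeSplitting c t).2.1).image ?_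
    exact continuous_id.smul continuous_const
  -- Write `z = h • I` and choose `p` with `p h` small. Its norm is nonzero by anisotropy, so `p =
  -- yγ` for the chosen representative `y`, and `y (γ h) = p h` places `γ h` in `B y`.
  · obtain ⟨p, hp0, hp⟩ := exists_quaternion_mul_lt z.toSL2R
    let x : X := ⟨p, fun h => hp0 (eq_zero_of_norm_eq_zero h), abs_norm_le hp⟩
    let y : X := rangeSplitting c ⟨c x, x, rfl⟩
    have hxy : c y = c x := apply_rangeSplitting c ⟨c x, x, rfl⟩
    have h1 : y.1.norm = p.norm := congrArg (fun t : T => (t.1 : ℤ)) hxy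
    have hdvd : 3 * y.1.norm ∣ (N : ℤ) := by
      have h2 : y.1.norm.natAbs ∣ Nat.factorial 8 := by
        refine Nat.dvd_factorial (Int.natAbs_pos.2 y.2.1) ?_
        have := y.2.2
        rw [Int.abs_eq_natAbs] at this
        exact_mod_cast this
      have h3 := mul_dvd_mul_left 3 (Int.natAbs_dvd.1 (Int.natCast_dvd_natCast.2 h2))
      simpa [N] using h3
    have hmod : ∀ a b : ℤ, (b : ZMod N) = a → ∃ r, a = b + 3 * y.1.norm * r := by
      intro a b hab
      obtain ⟨r, hr⟩ := hdvd.trans ((ZMod.intCast_eq_intCast_iff_dvd_sub b a N).1 hab)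
      exact ⟨r, by rw [← hr]; ring⟩
    obtain ⟨r0, hr0⟩ := hmod p.re y.1.re (congrArg (fun t : T => t.2.1) hxy)
    obtain ⟨r1, hr1⟩ := hmod p.imI y.1.imI (congrArg (fun t : T => t.2.2.1) hxy)
    obtain ⟨r2, hr2⟩ := hmod p.imJ y.1.imJ (congrArg (fun t : T => t.2.2.2.1) hxy)
    obtain ⟨r3, hr3⟩ := hmod p.imK y.1.imK (congrArg (fun t : T => t.2.2.2.2) hxy)
    obtain ⟨γ, hγ, hγp⟩ := exists_mem_quaternionGroup_mul h1.symm y.2.1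
      (r := ⟨r0, r1, r2, r3⟩) (p := p) (by
        ext
        · rw [QuaternionAlgebra.re_add, QuaternionAlgebra.re_smul, hr0, smul_eq_mul]
        · rw [QuaternionAlgebra.imI_add, QuaternionAlgebra.imI_smul, hr1, smul_eq_mul]
        · rw [QuaternionAlgebra.imJ_add, QuaternionAlgebra.imJ_smul, hr2, smul_eq_mul]
        · rw [QuaternionAlgebra.imK_add, QuaternionAlgebra.imK_smul, hr3, smul_eq_mul])
    refine ⟨γ, hγ, mem_iUnion.2 ⟨⟨c x, x, rfl⟩, γ * z.toSL2R, fun i j => ?_, ?_⟩⟩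
    · rw [Matrix.SpecialLinearGroup.coe_mul, ← mul_assoc, hγp]
      exact (hp i j).le
    · change (γ * z.toSL2R) • UpperHalfPlane.I = γ • z
      rw [mul_smul, toSL2R_smul_I]

end QuaternionGroup

/-! ### A free subgroup of the quaternion group -/

section FreeSubgroup

open UpperHalfPlane MatrixGroups QuaternionOrder

/-- The Pell identity `1351² - 3 · 780² = 1`, coming from `(2 + √3)⁶ = 1351 + 780√3`. The sixth
power is the first whose coefficients are congruent to `1` and `0` modulo `3`. -/
lemma norm_one_add_smul_freeQuaternion (b : Bool) :
    QuaternionOrder.norm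
      (1 + (3 : ℤ) • ⟨450, 0, if b then 260 else 0, if b then 0 else -260⟩) = 1 := by
  rw [QuaternionOrder.norm]
  simp only [QuaternionAlgebra.re_add, QuaternionAlgebra.re_smul, QuaternionAlgebra.re_one,
    QuaternionAlgebra.imI_add, QuaternionAlgebra.imI_smul, QuaternionAlgebra.imI_one,
    QuaternionAlgebra.imJ_add, QuaternionAlgebra.imJ_smul, QuaternionAlgebra.imJ_one,
    QuaternionAlgebra.imK_add, QuaternionAlgebra.imK_smul, QuaternionAlgebra.imK_one]
  cases b <;> norm_num

/-- Two hyperbolic elements with disjoint axes. -/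
noncomputable def pingPongElement (b : Bool) : quaternionGroup :=
  ⟨⟨toMatrix (1 + (3 : ℤ) • ⟨450, 0, if b then 260 else 0, if b then 0 else -260⟩), by
    rw [det_toMatrix, norm_one_add_smul_freeQuaternion, Int.cast_one]⟩, ⟨_, rfl⟩⟩

lemma coe_pingPongElement_true : ((pingPongElement true : SL(2, ℝ)) : Matrix (Fin 2) (Fin 2) ℝ) =
    !![1351 + 780 * √3, 0; 0, 1351 - 780 * √3] := by
  change toMatrix _ = _
  rw [toMatrix_apply]
  simp only [QuaternionAlgebra.re_add, QuaternionAlgebra.re_smul, QuaternionAlgebra.re_one,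
    QuaternionAlgebra.imI_add, QuaternionAlgebra.imI_smul, QuaternionAlgebra.imI_one,
    QuaternionAlgebra.imJ_add, QuaternionAlgebra.imJ_smul, QuaternionAlgebra.imJ_one,
    QuaternionAlgebra.imK_add, QuaternionAlgebra.imK_smul, QuaternionAlgebra.imK_one]
  norm_num

lemma coe_pingPongElement_false : ((pingPongElement false : SL(2, ℝ)) : Matrix (Fin 2) (Fin 2) ℝ) =
    !![1351, 780 * √3; 780 * √3, 1351] := by
  change toMatrix _ = _
  rw [toMatrix_apply]
  simp only [QuaternionAlgebra.re_add, QuaternionAlgebra.re_smul, QuaternionAlgebra.re_one,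
    QuaternionAlgebra.imI_add, QuaternionAlgebra.imI_smul, QuaternionAlgebra.imI_one,
    QuaternionAlgebra.imJ_add, QuaternionAlgebra.imJ_smul, QuaternionAlgebra.imJ_one,
    QuaternionAlgebra.imK_add, QuaternionAlgebra.imK_smul, QuaternionAlgebra.imK_one]
  norm_num

/-- The attracting disc of an element of the pair. -/
def attractingSet (b : Bool) : Set ℍ :=
  {z | if b then 9 < Complex.normSq z else 9 * Complex.normSq (z - 1) < Complex.normSq (z + 1)}

/-- The repelling disc of an element of the pair. -/
def repellingSet (b : Bool) : Set ℍ :=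
  {z | if b then 9 * Complex.normSq z < 1 else 9 * Complex.normSq (z + 1) < Complex.normSq (z - 1)}

/-- The shift by `s` serves to follow `|z|`, `|z + 1|` and `|z - 1|` under a Möbius map, at the
common cost of the factor `|cz + d|²`. -/
lemma normSq_smul_eq {g : SL(2, ℝ)} (z : ℍ) (s : ℝ) :
    Complex.normSq ((g • z : ℍ) + s) * Complex.normSq (g 1 0 * z + g 1 1) =
      Complex.normSq ((g 0 0 + s * g 1 0) * z + (g 0 1 + s * g 1 1)) := by
  have hden : ((g 1 0 : ℝ) : ℂ) * z + (g 1 1 : ℝ) ≠ 0 :=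
    denom_ne_zero (g : GL (Fin 2) ℝ) z
  rw [← map_mul, coe_specialLinearGroup_apply]
  simp only [Algebra.algebraMap_self, RingHom.id_apply]
  congr 1
  rw [add_mul, div_mul_cancel₀ _ hden]
  ring

lemma normSq_den_pos (g : SL(2, ℝ)) (z : ℍ) : 0 < Complex.normSq (g 1 0 * z + g 1 1) :=
  Complex.normSq_pos.2 (denom_ne_zero (g : GL (Fin 2) ℝ) z)

lemma normSq_ofReal_mul (t : ℝ) (z : ℂ) :
    Complex.normSq (t * z) = t ^ 2 * Complex.normSq z := by
  rw [map_mul, Complex.normSq_ofReal, sq]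

/-- The element `true` fixes `0` and `∞` and multiplies `|z|` by `(1351 + 780√3)²`; the element
`false` fixes `±1` and multiplies `|z + 1| / |z - 1|` by the same number. A factor greater than `9`
takes ratios at least `1/3` to ratios greater than `3`. -/
lemma smul_mem_attractingSet (b : Bool) {z : ℍ} (hz : z ∉ repellingSet b) :
    pingPongElement b • z ∈ attractingSet b := by
  have h3 : (√3 : ℝ) ^ 2 = 3 := Real.sq_sqrt (by norm_num)
  have h0 : 0 ≤ √3 := Real.sqrt_nonneg 3
  -- The two eigenvalues are mutually inverse; squares of absolute values occur below, hence `81 =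
  -- 9²`.
  have hαδ : 81 * (1351 - 780 * √3) ^ 2 < (1351 + 780 * √3) ^ 2 := by
    have h1 : (1351 - 780 * √3) * (1351 + 780 * √3) = 1 := by linear_combination -608400 * h3
    nlinarith
  change (pingPongElement b : SL(2, ℝ)) • z ∈ attractingSet b
  have hD := normSq_den_pos (pingPongElement b : SL(2, ℝ)) z
  have hS := fun s => normSq_smul_eq (g := (pingPongElement b : SL(2, ℝ))) z s
  cases b
  · simp only [repellingSet, Bool.false_eq_true, if_false, mem_ofPred_eq, not_lt] at hz
    simp only [attractingSet, Bool.false_eq_true, if_false, mem_ofPred_eq]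
    have h1 := hS 1
    have h2 := hS (-1)
    simp only [coe_pingPongElement_false, Matrix.of_apply, Matrix.cons_val', Matrix.cons_val_zero,
      Matrix.cons_val_one, Matrix.cons_val_fin_one] at h1 h2 hD
    -- The rows `(1, 1)` and `(1, -1)` are left eigenvectors of this symmetric matrix, with
    -- eigenvalues `1351 ± 780√3`.
    have e1 : Complex.normSq (((1351 : ℝ) + (1 : ℝ) * (780 * √3 : ℝ)) * z +
        ((780 * √3 : ℝ) + (1 : ℝ) * (1351 : ℝ))) = (1351 + 780 * √3) ^ 2 * Complex.normSq (z + 1) := by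
      rw [← normSq_ofReal_mul]
      congr 1
      push_cast
      ring
    have e2 : Complex.normSq (((1351 : ℝ) + (-1 : ℝ) * (780 * √3 : ℝ)) * z +
        ((780 * √3 : ℝ) + (-1 : ℝ) * (1351 : ℝ))) =
        (1351 - 780 * √3) ^ 2 * Complex.normSq (z - 1) := by
      rw [← normSq_ofReal_mul]
      congr 1
      push_cast
      ring
    rw [e1] at h1
    rw [e2] at h2
    have hp : 0 < Complex.normSq ((z : ℂ) + 1) := by
      refine Complex.normSq_pos.2 fun h => z.im_ne_zero ?_
      simpa using congrArg Complex.im h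
    refine lt_of_mul_lt_mul_right ?_ hD.le
    rw [mul_assoc]
    rw [show ((-1 : ℝ) : ℂ) = -1 by simp, ← sub_eq_add_neg] at h2
    rw [Complex.ofReal_one] at h1
    rw [h1, h2]
    nlinarith [sq_nonneg (1351 - 780 * √3)]
  · simp only [repellingSet, if_true, mem_ofPred_eq, not_lt] at hz
    simp only [attractingSet, if_true, mem_ofPred_eq]
    have h1 := hS 0
    simp only [coe_pingPongElement_true, Matrix.of_apply, Matrix.cons_val', Matrix.cons_val_zero,
      Matrix.cons_val_one, Matrix.cons_val_fin_one] at h1 hD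
    simp only [Complex.ofReal_zero, zero_mul, zero_add, add_zero, mul_zero,
      Complex.normSq_ofReal, normSq_ofReal_mul] at h1 hD
    nlinarith

lemma pairwise_disjoint_of_bool {α : Type*} {X : Bool → Set α} (h : Disjoint (X true) (X false)) :
    Pairwise (Function.onFun Disjoint X) := by
  intro a b hab
  cases a <;> cases b
  · exact absurd rfl hab
  · exact h.symm
  · exact h
  · exact absurd rfl hab

/-- Ping-pong with four disjoint regions of `ℍ`: `|z| > 3`, `|z| < 1/3`, and the Apollonius discs of
ratio `3` about `1` and `-1`, which have centres `±5/4` and radius `3/4`. -/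
theorem injective_lift_pingPongElement : Function.Injective (FreeGroup.lift pingPongElement) := by
  have hn : ∀ z : ℍ, Complex.normSq z = z.re ^ 2 + z.im ^ 2 := fun z => by
    rw [Complex.normSq_apply, sq, sq]
    rfl
  have hp : ∀ z : ℍ, Complex.normSq ((z : ℂ) + 1) = (z.re + 1) ^ 2 + z.im ^ 2 := fun z => by
    simp [Complex.normSq_apply, sq]
  have hm : ∀ z : ℍ, Complex.normSq ((z : ℂ) - 1) = (z.re - 1) ^ 2 + z.im ^ 2 := fun z => by
    simp [Complex.normSq_apply, sq]
  have hX : Disjoint (attractingSet true) (attractingSet false) := by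
    refine Set.disjoint_left.2 fun z h1 h2 => ?_
    simp only [attractingSet, Bool.false_eq_true, if_false, if_true, mem_ofPred_eq, hn, hp,
      hm] at h1 h2
    nlinarith [sq_nonneg (z.re - 2), sq_nonneg z.im]
  have hY : Disjoint (repellingSet true) (repellingSet false) := by
    refine Set.disjoint_left.2 fun z h1 h2 => ?_
    simp only [repellingSet, Bool.false_eq_true, if_false, if_true, mem_ofPred_eq, hn, hp,
      hm] at h1 h2
    nlinarith [sq_nonneg (2 * z.re + 1), sq_nonneg z.im]
  have hXY : ∀ i j, Disjoint (attractingSet i) (repellingSet j) := by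
    intro i j
    refine Set.disjoint_left.2 fun z h1 h2 => ?_
    cases i <;> cases j <;> simp only [attractingSet, repellingSet, Bool.false_eq_true, if_false,
      if_true, mem_ofPred_eq, hn, hp, hm] at h1 h2
    · nlinarith [sq_nonneg z.re, sq_nonneg z.im]
    · nlinarith [sq_nonneg (2 * z.re - 1), sq_nonneg z.im]
    · nlinarith [sq_nonneg (z.re + 2), sq_nonneg z.im]
    · nlinarith [sq_nonneg z.re, sq_nonneg z.im]
  refine FreeGroup.injective_lift_of_ping_pong pingPongElement attractingSet repellingSet ?_
    (pairwise_disjoint_of_bool hX) (pairwise_disjoint_of_bool hY) hXY ?_ ?_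
  · intro i
    cases i
    · refine ⟨⟨⟨1, 1 / 3⟩, by norm_num⟩, ?_⟩
      simp only [attractingSet, Bool.false_eq_true, if_false, mem_ofPred_eq, Complex.normSq_apply]
      norm_num
    · refine ⟨⟨⟨0, 4⟩, by norm_num⟩, ?_⟩
      simp only [attractingSet, if_true, mem_ofPred_eq, Complex.normSq_apply]
      norm_num
  · rintro i _ ⟨z, hz, rfl⟩
    exact smul_mem_attractingSet i hz
  -- If the inverse image of `z` were outside the repelling set, applying the element would put `z`
  -- in the attracting set.
  · rintro i _ ⟨z, hz, rfl⟩
    by_contra h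
    have h1 := smul_mem_attractingSet i h
    rw [Pi.inv_apply] at h1
    simp only [smul_inv_smul] at h1
    exact hz h1

end FreeSubgroup

/-! ### Countable free groups inside a surface group, and the theorem. -/

theorem FICwFForNonpositivelyCurved.freeGroup_int {R : Type v} [Ring R]
    {ℋ : EquivariantHomologyTheory.{u, v, w} R} {𝓕 : GroupClass.{u}}
    (h : FICwFForNonpositivelyCurved ℋ 𝓕) : SatisfiesFICwF ℋ 𝓕 (FreeGroup (ULift.{u} ℤ)) := by
  obtain ⟨K, hK, hΓ⟩ := exists_isCompact_quaternionGroup_smul_mem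
  obtain ⟨f, hf⟩ := exists_embedding_freeGroup_bool
  exact h.freeGroup quaternionGroup hK hΓ (f := (FreeGroup.lift pingPongElement).comp f)
    (injective_lift_pingPongElement.comp hf)

theorem mainTheorem8 (G₁ G₂ : Type u) [Group G₁] [Group G₂] [Countable G₁] [Countable G₂] :
    (∀ (R : Type v) [Ring R] (ℋ : EquivariantHomologyTheory.{u, v, w} R) (𝓕 : GroupClass.{u}),
      FICwFForNonpositivelyCurved ℋ 𝓕 → FICForVirtuallyAbelian ℋ 𝓕 → FICForColimits ℋ 𝓕 → FICForPreimages ℋ 𝓕 →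
      SatisfiesFICwF ℋ 𝓕 G₁ → SatisfiesFICwF ℋ 𝓕 G₂ →
      SatisfiesFICwF ℋ 𝓕 (Monoid.Coprod G₁ G₂)) ∧
    (∀ V : Subgroup (G₁ × G₂), VirtuallyCyclic V →
      ∃ (S : Type) (H : Type u) (_ : Group H), Countable S ∧ Finite H ∧
        ∃ e : V.comap (Monoid.Coprod.toProd : Monoid.Coprod G₁ G₂ →* G₁ × G₂) →*
          FreeGroup S ≀ᵣ H, Function.Injective e) := by
  refine ⟨fun R _ ℋ 𝓕 h2 h3 _ h5 hG1 hG2 => ?_, fun V hV => ?_⟩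
  · exact SatisfiesFICwF.of_comap_cyclic h3 h5 h2.freeGroup_int (hG1.prod h3 h5 hG2)
      Monoid.Coprod.toProd fun C hC => virtuallyFreePower_comap_toProd C hC
  · exact exists_embedding_wreathProduct_of_comap_toProd V hV
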